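/- Let $n\ge 2$ and $1\le k\le n-1$. Let $\Sigma^{n-1}$ be a smooth closed (compact, without boundary) hypersurface in Euclidean space $\mathbb{R}^n$, possibly only immersed, with position map $X$ and a smooth unit normal field $\nu$ (for instance the outward unit normal if $\Sigma$ is embedded). Let $g$ be the induced metric, with Riemannian measure $d\mu$, and let $h$ be the second fundamental form, $h_{ij}=\langle \partial_i\nu,\partial_jX\rangle$, which is positive on round spheres with the outward normal. Let $\kappa_1,\dots,\kappa_{n-1}$ be the principal curvatures, that is, the eigenvalues of the shape operator $h_i^j=g^{jl}h_{il}$, and put $$\sigma_j=\sum_{1\le i_1<\cdots<i_j\le n-1}\kappa_{i_1}\cdots\kappa_{i_j},\qquad H_j=\frac{\sigma_j}{C_{n-1}^j},\qquad \sigma_0=H_0=1,$$ where $C_{n-1}^j$ is the binomial coefficient. Let $(T_j)^i_l=\partial\sigma_{j+1}/\partial h_i^l$ be the Newton tensors, with $\sigma_{j+1}$ regarded as a polynomial in the entries of the shape operator, and $(T_j)^{il}=(T_j)^i_s\,g^{sl}$. Fix a point $O\in\mathbb{R}^n$, let $r=|X-O|$ be the distance to $O$, and let $u=\langle X-O,\nu\rangle$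 be the support function with respect to $O$. Let $\nabla$ denote covariant differentiation on $\Sigma$. Then all the integrands below are integrable, and $$\int_{\Sigma}r^2u\,H_k\,d\mu=\int_{\Sigma}r^2H_{k-1}\,d\mu+\frac{1}{2k\,C_{n-1}^k}\int_{\Sigma}(T_{k-1})^{ij}\,\nabla_i(r^2)\,\nabla_j(r^2)\,d\mu,$$ $$\int_{\Sigma}u^2H_k\,d\mu=\int_{\Sigma}u\,H_{k-1}\,d\mu+\frac{1}{4k\,C_{n-1}^k}\int_{\Sigma}(T_{k-1})^{ij}\,h_i^l\,\nabla_j(r^2)\,\nabla_l(r^2)\,d\mu.$$ -/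

import Mathlib

open scoped Manifold ContDiff
open MeasureTheory

namespace Hypersurface

noncomputable section

/-- The Euclidean space of dimension `n`. -/
abbrev Euc (n : ℕ) : Type := EuclideanSpace ℝ (Fin n)

/-! ### Elementary symmetric functions and Newton tensors of a matrix -/

/-- The `k`-th elementary symmetric function of the (complex) eigenvalues of a square matrix,
as a polynomial in its entries: the coefficient of `t ^ k` in `det (1 + t A)`. -/
def sigmaMatrix {m : ℕ} (k : ℕ) (A : Matrix (Fin m) (Fin m) ℝ) : ℝ :=
  (1 + (Polynomial.X : Polynomial ℝ) • A.map Polynomial.C).det.coeff k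

/-- On a matrix with real eigenvalues, `sigmaMatrix` is the elementary symmetric function of the
eigenvalues. -/
theorem sigmaMatrix_eq_esymm {m : ℕ} (k : ℕ) (hk : k ≤ m) (A : Matrix (Fin m) (Fin m) ℝ)
    (hA : A.charpoly.Splits) : sigmaMatrix k A = A.charpoly.roots.esymm k := by
  have h1 := Matrix.charpoly_coeff_eq_sum_minors A k (by simpa using hk)
  have h2 := Matrix.coeff_det_one_add_X_smul_eq_sum_minors A k
  have hcard : A.charpoly.roots.card = A.charpoly.natDegree := hA.natDegree_eq_card_roots.symm
  have h3 := Polynomial.coeff_eq_esymm_roots_of_card hcard (k := m - k) (by simp)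
  have hm : A.charpoly.natDegree = m := by simp
  rw [hm, (Matrix.charpoly_monic A).leadingCoeff, Nat.sub_sub_self hk] at h3
  simp only [Fintype.card_fin] at h1
  unfold sigmaMatrix
  rw [h2]
  rw [h1] at h3
  have : ((-1 : ℝ) ^ k) ≠ 0 := by positivity
  simpa [this] using h3

/-- The Newton tensor `T_k`, `(T_k)^i_j = ∂ σ_{k+1} / ∂ h_i^j`, as a function of the matrix
`A = (h_i^j)` with row index `i` and column index `j`. -/
def newton {m : ℕ} (k : ℕ) (A : Matrix (Fin m) (Fin m) ℝ) : Matrix (Fin m) (Fin m) ℝ :=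
  Matrix.of fun i j => deriv (fun t : ℝ => sigmaMatrix (k + 1) (A + t • Matrix.single i j 1)) 0

/-! ### Local coordinate expressions

`Y` is a local parametrization of a hypersurface, `N` the unit normal in the same coordinates. -/

/-- The partial derivative `∂_i F` at `x`. -/
def partialAt {m : ℕ} {F : Type*} [NormedAddCommGroup F] [NormedSpace ℝ F]
    (f : Euc m → F) (x : Euc m) (i : Fin m) : F :=
  fderiv ℝ f x (EuclideanSpace.single i 1)

/-- The coefficients `g_ij = ⟨∂_i Y, ∂_j Y⟩` of the induced metric. -/
def metricCoeff {m n : ℕ} (Y : Euc m → Euc n) (x : Euc m) : Matrix (Fin m) (Fin m) ℝ :=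
  Matrix.of fun i j => inner ℝ (partialAt Y x i) (partialAt Y x j)

/-- The coefficients `h_ij = ⟨∂_i N, ∂_j Y⟩ = - ⟨∂_i ∂_j Y, N⟩` of the second fundamental form
(positive on round spheres with the outer normal). -/
def sffCoeff {m n : ℕ} (Y N : Euc m → Euc n) (x : Euc m) : Matrix (Fin m) (Fin m) ℝ :=
  Matrix.of fun i j => inner ℝ (partialAt N x i) (partialAt Y x j)

/-- The shape operator `h_i^j = ∑ l, g^{jl} h_{il}` (row `i`, column `j`). -/
def shapeCoeff {m n : ℕ} (Y N : Euc m → Euc n) (x : Euc m) : Matrix (Fin m) (Fin m) ℝ :=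
  Matrix.of fun i j => ∑ l, (metricCoeff Y x)⁻¹ j l * sffCoeff Y N x i l

/-- The Newton tensor with two upper indices, `(T_k)^{ij} = ∑ l, (T_k)^i_l g^{lj}`. -/
def newtonUpper {m n : ℕ} (k : ℕ) (Y N : Euc m → Euc n) (x : Euc m) :
    Matrix (Fin m) (Fin m) ℝ :=
  Matrix.of fun i j => ∑ l, newton k (shapeCoeff Y N x) i l * (metricCoeff Y x)⁻¹ l j

/-! ### Global objects on an immersed hypersurface -/

variable {m n : ℕ} {M : Type*} [TopologicalSpace M] [ChartedSpace (Euc m) M]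

/-- `X : M → ℝⁿ` is a smooth immersion and `ν` is a smooth unit normal field along `X`. When
`m + 1 = n` this says that `X` is an immersed hypersurface oriented by `ν`. -/
structure IsImmersedWithUnitNormal (X ν : M → Euc n) : Prop where
  smooth : ContMDiff (𝓡 m) 𝓘(ℝ, Euc n) ∞ X
  immersion : ∀ p : M, Function.Injective (mfderiv (𝓡 m) 𝓘(ℝ, Euc n) X p)
  smooth_normal : ContMDiff (𝓡 m) 𝓘(ℝ, Euc n) ∞ ν
  norm_normal : ∀ p : M, ‖ν p‖ = 1
  normal : ∀ (p : M) (v : TangentSpace (𝓡 m) p),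
    inner ℝ (ν p) (mfderiv (𝓡 m) 𝓘(ℝ, Euc n) X p v : Euc n) = 0

/-- The expression of a function on `M` in the local coordinates around `p`. -/
def localExpr {F : Type*} (f : M → F) (p : M) : Euc m → F :=
  f ∘ (chartAt (Euc m) p).symm

/-- The coordinates of `p` itself in the local coordinates around `p`. -/
def coordsAt (p : M) : Euc m := chartAt (Euc m) p p

/-- The matrix `h_i^j` of the shape operator at `p`, in the local coordinates around `p`. -/
def shapeAt (X ν : M → Euc n) (p : M) : Matrix (Fin m) (Fin m) ℝ :=
  shapeCoeff (localExpr (m := m) X p) (localExpr ν p) (coordsAt p)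

/-- The principal curvatures at `p`: the eigenvalues of the shape operator, with multiplicity. -/
def principalCurvatures (X ν : M → Euc n) (p : M) : Multiset ℝ :=
  (shapeAt (m := m) X ν p).charpoly.roots

/-- The normalized `k`-th mean curvature `H_k = σ_k(κ) / C(m, k)`. -/
def H (m : ℕ) {n : ℕ} {M : Type*} [TopologicalSpace M] [ChartedSpace (Euc m) M]
    (k : ℕ) (X ν : M → Euc n) (p : M) : ℝ :=
  (principalCurvatures (m := m) X ν p).esymm k / (m.choose k : ℝ)

/-- `(T_k)^{ij} ∇_i f ∇_j f` at `p`. -/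
def newtonGrad (m : ℕ) {n : ℕ} {M : Type*} [TopologicalSpace M] [ChartedSpace (Euc m) M]
    (k : ℕ) (X ν : M → Euc n) (f : M → ℝ) (p : M) : ℝ :=
  ∑ i : Fin m, ∑ j : Fin m,
    newtonUpper k (localExpr (m := m) X p) (localExpr ν p) (coordsAt p) i j
      * partialAt (localExpr f p) (coordsAt p) i * partialAt (localExpr f p) (coordsAt p) j

/-- `(T_k)^{ij} h_i^l ∇_j f ∇_l f` at `p`. -/
def newtonShapeGrad (m : ℕ) {n : ℕ} {M : Type*} [TopologicalSpace M] [ChartedSpace (Euc m) M]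
    (k : ℕ) (X ν : M → Euc n) (f : M → ℝ) (p : M) : ℝ :=
  ∑ i : Fin m, ∑ j : Fin m, ∑ l : Fin m,
    newtonUpper k (localExpr (m := m) X p) (localExpr ν p) (coordsAt p) i j
      * shapeAt (m := m) X ν p i l
      * partialAt (localExpr f p) (coordsAt p) j * partialAt (localExpr f p) (coordsAt p) l

/-- The Riemannian measure `dμ` of the metric induced by `X`. In each chart of the atlas it is
`√(det g_ij) dx`; as these measures agree on overlaps of charts, the measure they define on `M`
is their least upper bound. -/
def areaMeasure (m : ℕ) {n : ℕ} {M : Type*} [TopologicalSpace M] [ChartedSpace (Euc m) M]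
    [MeasurableSpace M] (X : M → Euc n) : Measure M :=
  ⨆ e ∈ atlas (Euc m) M, Measure.map e.symm
    ((volume.restrict e.target).withDensity
      fun x => ENNReal.ofReal (Real.sqrt (metricCoeff (X ∘ e.symm) x).det))

/-- The square `r²` of the distance to the point `O`. -/
def rsq (O : Euc n) (X : M → Euc n) (p : M) : ℝ := dist (X p) O ^ 2

/-- The support function `u = ⟨X, ν⟩`, the position vector being taken from the point `O`. -/
def support (O : Euc n) (X ν : M → Euc n) (p : M) : ℝ := inner ℝ (X p - O) (ν p)

end

end Hypersurface

namespace Hypersurface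

noncomputable section

/-! ### Matrix algebra: generating functions of `sigmaMatrix` and `newton` -/

/-! Both formulas are the same weighted Minkowski identity, with weight $f=r^2$ and $f=u$. With
$m=n-1$, $j=k-1$ it reads $\int f\,((m-j)\sigma_j-(j+1)u\sigma_{j+1})\,d\mu=-\frac12\int T_j(\nabla
f,\nabla r^2)\,d\mu$ (`integral_newtonLaplace`), the bracket being the divergence of
$T_j\nabla(r^2/2)$. The relation $(m-j)C_m^j=(j+1)C_m^{j+1}$ turns it into a statement about $H_j$
and $H_{j+1}$, and $\nabla u=\frac12h(\nabla r^2)$ brings in the factor $h_i^l$ when $f=u$.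

The divergence is usually computed from the Codazzi equations, through $\operatorname{div}T_j=0$.
Here determinants do this work, for all $j$ at once. If $A$ is the shape operator, $\det(1+tA)=\sum
t^k\sigma_k$, and $\sum t^kT_k$ is the cofactor matrix of $1+tA$. As $1+tA$ carries the frame
$\partial_lY$ to $z_l=\partial_l(Y+tN)$, the field $\sqrt{\det g}\,\sum t^kT_k\nabla(r^2/2)$ has, up
to a locally constant sign, the components $\det(N,z_1,\dots,Y-O,\dots,z_m)$ with $Y-O$ in slot $i$
(`slotField_eq`). In its divergence the terms with $\partial_iz_l$, $l\ne i$, cancel in pairs,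
because $\partial_iz_l=\partial_lz_i$ while exchanging two slots changes the sign
(`sum_fderiv_slotField`). The terms left form $\sum_i\det$ of $1+tA$ with row $i$ replaced by
$e_i-uA_i$, and `sum_det_updateRow_trace` expands this sum in powers of $t$.

Integration by parts in a chart then gives the identity for weights supported there. Invariance of
$\sigma_k$, $T_k$ and the measure under changes of chart, together with a partition of unity, makes
it global; comparing coefficients of $t$ separates the individual $k$. -/

open Polynomial in
theorem coeff_eq_of_forall_sum_pow_mul_eq {N : ℕ} {a b : ℕ → ℝ}
    (h : ∀ t : ℝ, ∑ k ∈ Finset.range N, t ^ k * a k = ∑ k ∈ Finset.range N, t ^ k * b k)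
    {k : ℕ} (hk : k < N) : a k = b k := by
  have key : ∑ k ∈ Finset.range N, (C (a k) * X ^ k : ℝ[X])
      = ∑ k ∈ Finset.range N, C (b k) * X ^ k := by
    refine Polynomial.funext fun t => ?_
    simp only [eval_finsetSum, eval_mul, eval_C, eval_pow, eval_X]
    simp_rw [mul_comm (a _), mul_comm (b _)]
    exact h t
  have := congrArg (fun p => p.coeff k) key
  simpa [finsetSum_coeff, coeff_C_mul, coeff_X_pow, hk] using this

section MatrixAlgebra

variable {m : ℕ}

open Polynomial in
theorem eval_det_one_add_X_smul (A : Matrix (Fin m) (Fin m) ℝ) (t : ℝ) :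
    (1 + (X : ℝ[X]) • A.map C).det.eval t = (1 + t • A).det := by
  rw [← coe_evalRingHom, RingHom.map_det]
  congr 1
  ext i j
  by_cases hij : i = j <;> simp [hij, mul_comm t]

open Polynomial in
theorem natDegree_det_one_add_X_smul (A : Matrix (Fin m) (Fin m) ℝ) :
    (1 + (X : ℝ[X]) • A.map C).det.natDegree ≤ m := by
  have := natDegree_det_X_add_C_le A (1 : Matrix (Fin m) (Fin m) ℝ)
  rw [add_comm] at this
  simpa using this

theorem det_one_add_smul_eq_sum (A : Matrix (Fin m) (Fin m) ℝ) (t : ℝ) :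
    (1 + t • A).det = ∑ k ∈ Finset.range (m + 1), t ^ k * sigmaMatrix k A := by
  rw [← eval_det_one_add_X_smul, Polynomial.eval_eq_sum_range'
    (Nat.lt_succ_of_le (natDegree_det_one_add_X_smul A))]
  simp [sigmaMatrix, mul_comm]

theorem sigmaMatrix_of_lt {k : ℕ} (hk : m < k) (A : Matrix (Fin m) (Fin m) ℝ) :
    sigmaMatrix k A = 0 :=
  Polynomial.coeff_eq_zero_of_natDegree_lt
    ((natDegree_det_one_add_X_smul A).trans_lt hk)

theorem continuous_sigmaMatrix (k : ℕ) :
    Continuous (sigmaMatrix k : Matrix (Fin m) (Fin m) ℝ → ℝ) := by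
  unfold sigmaMatrix
  simp_rw [Matrix.coeff_det_one_add_X_smul_eq_sum_minors]
  refine continuous_finsetSum _ fun s _ => Continuous.matrix_det ?_
  exact Continuous.matrix_submatrix continuous_id _ _

open Polynomial in
/-- `σ_{k+1}` is affine along coordinate directions, with slope given by a cofactor. -/
theorem sigmaMatrix_add_smul_single (k : ℕ) (A : Matrix (Fin m) (Fin m) ℝ) (i j : Fin m) (s : ℝ) :
    sigmaMatrix (k + 1) (A + s • Matrix.single i j 1) = sigmaMatrix (k + 1) A
      + s * ((1 + (X : ℝ[X]) • A.map C).updateRow i (Pi.single j 1)).det.coeff k := by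
  have h : (1 + (X : ℝ[X]) • (A + s • Matrix.single i j 1).map C)
      = (1 + (X : ℝ[X]) • A.map C).updateRow i
        ((1 + (X : ℝ[X]) • A.map C) i + (X * C s) • Pi.single j 1) := by
    ext1 a b
    by_cases ha : a = i
    · subst ha
      by_cases hb : b = j
      · subst hb
        simp [mul_add, add_assoc]
      · simp [hb, Ne.symm hb]
    · simp [Matrix.updateRow_ne ha, Ne.symm ha]
  unfold sigmaMatrix
  rw [h, Matrix.det_updateRow_add, Matrix.det_updateRow_smul, Matrix.updateRow_eq_self]
  rw [mul_assoc, coeff_add, coeff_X_mul, coeff_C_mul]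

open Polynomial in
theorem newton_eq_coeff (k : ℕ) (A : Matrix (Fin m) (Fin m) ℝ) (i j : Fin m) :
    newton k A i j
      = ((1 + (X : ℝ[X]) • A.map C).updateRow i (Pi.single j 1)).det.coeff k := by
  simp only [newton, Matrix.of_apply, sigmaMatrix_add_smul_single]
  simp

/-- Affineness in each entry makes the derivative an exact difference, from which continuity in `A`
is immediate. -/
theorem newton_eq_sub (k : ℕ) (A : Matrix (Fin m) (Fin m) ℝ) (i j : Fin m) :
    newton k A i j = sigmaMatrix (k + 1) (A + Matrix.single i j 1) - sigmaMatrix (k + 1) A := by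
  have := sigmaMatrix_add_smul_single k A i j 1
  rw [one_smul] at this
  rw [newton_eq_coeff, this]
  ring

theorem continuous_newton_apply (k : ℕ) (i j : Fin m) :
    Continuous fun A : Matrix (Fin m) (Fin m) ℝ => newton k A i j := by
  simp_rw [newton_eq_sub]
  exact ((continuous_sigmaMatrix _).comp (continuous_id.add continuous_const)).sub
    (continuous_sigmaMatrix _)

open Polynomial in
theorem sum_pow_mul_newton (A : Matrix (Fin m) (Fin m) ℝ) (i j : Fin m) (t : ℝ) :
    ∑ k ∈ Finset.range (m + 1), t ^ k * newton k A i j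
      = ((1 + t • A).updateRow i (Pi.single j 1)).det := by
  set p := ((1 + (X : ℝ[X]) • A.map C).updateRow i (Pi.single j 1)).det with hp
  have hdeg : p.natDegree ≤ m := by
    -- Row `i` is free of the variable, so the matrix is `X` times `A` with row `i` erased, plus a
    -- constant matrix.
    have := natDegree_det_X_add_C_le (A.updateRow i 0)
      ((1 : Matrix (Fin m) (Fin m) ℝ).updateRow i (Pi.single j 1))
    have hn : p.natDegree ≤ Fintype.card (Fin m) := by
      refine le_trans (le_of_eq ?_) this
      rw [hp]
      congr 2
      ext1 a b
      by_cases ha : a = i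
      · subst ha; simp [Pi.single_apply, apply_ite]
      · simp [Matrix.updateRow_ne ha, Matrix.one_apply, apply_ite, add_comm]
    simpa using hn
  have he : p.eval t = ((1 + t • A).updateRow i (Pi.single j 1)).det := by
    rw [hp, ← coe_evalRingHom, RingHom.map_det]
    congr 1
    ext a b
    by_cases ha : a = i
    · subst ha; simp [Pi.single_apply, apply_ite]
    · have ht : eval t ((1 + (X : ℝ[X]) • A.map C) a b) = (1 + t • A) a b := by
        by_cases hab : a = b <;> simp [hab, mul_comm t]
      simpa [Matrix.updateRow_ne ha] using ht
  rw [← he, Polynomial.eval_eq_sum_range' (Nat.lt_succ_of_le hdeg)]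
  simp [newton_eq_coeff, hp, mul_comm]

/-- Expansion along row `i`, read off from Cramer's rule. -/
theorem sum_det_updateRow_single (B : Matrix (Fin m) (Fin m) ℝ) (i : Fin m) (c : Fin m → ℝ) :
    ∑ j, (B.updateRow i (Pi.single j 1)).det * c j = (B.updateRow i c).det := by
  simp_rw [← Matrix.cramer_transpose_apply, Matrix.cramer_eq_adjugate_mulVec]
  simp [Matrix.mulVec, dotProduct, Pi.single_apply]

/-- The bilinear form `(v, c) ↦ ∑ (T_k)^i_j v_i c^j` attached to the Newton tensor. -/
def newtonForm (k : ℕ) (A : Matrix (Fin m) (Fin m) ℝ) (v c : Fin m → ℝ) : ℝ :=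
  ∑ i, ∑ j, newton k A i j * v i * c j

theorem sum_pow_mul_newtonForm (A : Matrix (Fin m) (Fin m) ℝ) (v c : Fin m → ℝ) (t : ℝ) :
    ∑ k ∈ Finset.range (m + 1), t ^ k * newtonForm k A v c
      = ∑ i, v i * ((1 + t • A).updateRow i c).det := by
  simp_rw [newtonForm, Finset.mul_sum]
  rw [Finset.sum_comm]
  refine Finset.sum_congr rfl fun i _ => ?_
  rw [Finset.sum_comm, ← sum_det_updateRow_single, Finset.mul_sum]
  refine Finset.sum_congr rfl fun j _ => ?_
  rw [← sum_pow_mul_newton, Finset.sum_mul, Finset.mul_sum]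
  refine Finset.sum_congr rfl fun k _ => ?_
  ring

theorem one_add_smul_conj {J K : Matrix (Fin m) (Fin m) ℝ} (h : J * K = 1)
    (A : Matrix (Fin m) (Fin m) ℝ) (t : ℝ) :
    1 + t • (J * A * K) = J * (1 + t • A) * K := by
  rw [mul_add, add_mul, mul_one, h]
  simp

theorem sigmaMatrix_conj {J K : Matrix (Fin m) (Fin m) ℝ} (h : J * K = 1) (k : ℕ)
    (A : Matrix (Fin m) (Fin m) ℝ) : sigmaMatrix k (J * A * K) = sigmaMatrix k A := by
  -- Comparison of coefficients only reaches degrees up to `m`; above `m` both sides vanish.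
  rcases lt_or_ge m k with hk | hk
  · rw [sigmaMatrix_of_lt hk, sigmaMatrix_of_lt hk]
  refine coeff_eq_of_forall_sum_pow_mul_eq (N := m + 1)
    (a := fun k => sigmaMatrix k (J * A * K)) (b := fun k => sigmaMatrix k A)
    (fun t => ?_) (Nat.lt_succ_of_le hk)
  have hd : J.det * K.det = 1 := by rw [← Matrix.det_mul, h, Matrix.det_one]
  rw [← det_one_add_smul_eq_sum, ← det_one_add_smul_eq_sum, one_add_smul_conj h,
    Matrix.det_mul, Matrix.det_mul]
  linear_combination (1 + t • A).det * hd

/-- Tensoriality of $T_k$: under a coordinate change with Jacobian `J` and inverse `K`, covectors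
transform by `J` and vectors by the transpose of `K`. Summed against $t^k$, the form is
$v\cdot\operatorname{adj}(B^T)c$ with $B=1+tA$, and the adjugates of `J` and `K` contribute only
$\det J\det K=1$. -/
theorem newtonForm_conj {J K : Matrix (Fin m) (Fin m) ℝ} (h : J * K = 1) {k : ℕ} (hk : k ≤ m)
    (A : Matrix (Fin m) (Fin m) ℝ) (v c : Fin m → ℝ) :
    newtonForm k (J * A * K) (J.mulVec v) (K.transpose.mulVec c) = newtonForm k A v c := by
  refine coeff_eq_of_forall_sum_pow_mul_eq (N := m + 1)
    (a := fun k => newtonForm k (J * A * K) (J.mulVec v) (K.transpose.mulVec c))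
    (b := fun k => newtonForm k A v c) (fun t => ?_) (Nat.lt_succ_of_le hk)
  have hd : J.det * K.det = 1 := by rw [← Matrix.det_mul, h, Matrix.det_one]
  have key : ∀ (B : Matrix (Fin m) (Fin m) ℝ) (v c : Fin m → ℝ),
      ∑ i, v i * (B.updateRow i c).det = v ⬝ᵥ (B.transpose.adjugate.mulVec c) := by
    intro B v c
    simp_rw [← Matrix.cramer_transpose_apply, Matrix.cramer_eq_adjugate_mulVec]
    rfl
  rw [sum_pow_mul_newtonForm, sum_pow_mul_newtonForm, one_add_smul_conj h, key, key,
    Matrix.transpose_mul, Matrix.transpose_mul, Matrix.adjugate_mul_distrib,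
    Matrix.adjugate_mul_distrib, Matrix.mulVec_mulVec]
  have h1 : ((J.transpose.adjugate * (1 + t • A).transpose.adjugate) * K.transpose.adjugate)
      * K.transpose
      = K.det • (J.transpose.adjugate * (1 + t • A).transpose.adjugate) := by
    rw [mul_assoc, Matrix.adjugate_mul, Matrix.det_transpose]
    simp
  rw [h1, ← Matrix.vecMul_transpose, ← Matrix.dotProduct_mulVec,
    Matrix.mulVec_mulVec, Matrix.mul_smul, ← mul_assoc, Matrix.mul_adjugate,
    Matrix.det_transpose]
  simp only [Matrix.smul_mul, one_mul, Matrix.smul_mulVec, dotProduct_smul, smul_eq_mul]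
  linear_combination (v ⬝ᵥ (1 + t • A).transpose.adjugate.mulVec c) * hd

/-! ### Derivative of $\det(1+tA)$ and the expansion of the divergence. -/

/-- The determinant as a continuous multilinear map of the rows. -/
def detRowCLM (m : ℕ) : ContinuousMultilinearMap ℝ (fun _ : Fin m => Fin m → ℝ) ℝ where
  toMultilinearMap := (Matrix.detRowAlternating : (Fin m → ℝ) [⋀^Fin m]→ₗ[ℝ] ℝ).toMultilinearMap
  cont := by
    change Continuous fun A : Matrix (Fin m) (Fin m) ℝ => A.det
    exact Continuous.matrix_det continuous_id

theorem hasDerivAt_det_one_add_smul (A : Matrix (Fin m) (Fin m) ℝ) (t : ℝ) :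
    HasDerivAt (fun t : ℝ => (1 + t • A).det) (∑ i, ((1 + t • A).updateRow i (A i)).det) t := by
  have h : ∀ i : Fin m, HasFDerivAt (fun t : ℝ => (1 + t • A) i)
      (ContinuousLinearMap.smulRight (1 : ℝ →L[ℝ] ℝ) (A i)) t := by
    intro i
    have h1 : HasFDerivAt (fun t : ℝ => t • A i)
        (ContinuousLinearMap.smulRight (1 : ℝ →L[ℝ] ℝ) (A i)) t :=
      (hasFDerivAt_id t).smul_const (A i)
    exact h1.const_add ((1 : Matrix (Fin m) (Fin m) ℝ) i)
  have := (HasFDerivAt.multilinear_comp (f := detRowCLM m) h).hasDerivAt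
  refine this.congr_deriv ?_
  simp only [sum_apply, ContinuousLinearMap.comp_apply]
  refine Finset.sum_congr rfl fun i _ => ?_
  simp only [ContinuousLinearMap.smulRight_apply, one_apply_eq_self, one_smul]
  rfl

/-- Two computations of $\frac{d}{dt}\det(1+tA)$: row by row, and term by term in the expansion. -/
theorem sum_det_updateRow_shape (A : Matrix (Fin m) (Fin m) ℝ) (t : ℝ) :
    ∑ i, ((1 + t • A).updateRow i (A i)).det
      = ∑ k ∈ Finset.range (m + 1), t ^ k * ((k + 1 : ℝ) * sigmaMatrix (k + 1) A) := by
  refine (hasDerivAt_det_one_add_smul A t).unique ?_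
  simp_rw [det_one_add_smul_eq_sum]
  have h : HasDerivAt (fun s : ℝ => ∑ k ∈ Finset.range (m + 1), s ^ k * sigmaMatrix k A)
      (∑ k ∈ Finset.range (m + 1), ((k : ℝ) * t ^ (k - 1)) * sigmaMatrix k A) t :=
    HasDerivAt.fun_sum fun k _ => (hasDerivAt_pow k t).mul_const _
  refine h.congr_deriv ?_
  -- The index shift loses nothing: the term $k=0$ has the factor $k$, and the extra top term has
  -- $\sigma_{m+1}=0$.
  rw [Finset.sum_range_succ', Finset.sum_range_succ, sigmaMatrix_of_lt (Nat.lt_succ_self m)]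
  simp only [Nat.cast_zero, zero_mul, mul_zero, add_zero]
  refine Finset.sum_congr rfl fun k _ => ?_
  push_cast
  ring

/-- Since $e_i-uA_i$ is row $i$ of $1+tA$ minus $(t+u)A_i$, the sum is
$(m-t\frac{d}{dt}-u\frac{d}{dt})\det(1+tA)$. The Euler operator $t\frac{d}{dt}$ multiplies $t^k$ by
$k$, whence the factor $m-k$. -/
theorem sum_det_updateRow_trace (A : Matrix (Fin m) (Fin m) ℝ) (t u : ℝ) :
    ∑ i, ((1 + t • A).updateRow i ((1 : Matrix (Fin m) (Fin m) ℝ) i - u • A i)).det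
      = ∑ k ∈ Finset.range (m + 1), t ^ k * (((m : ℝ) - k) * sigmaMatrix k A
          - u * ((k + 1 : ℝ) * sigmaMatrix (k + 1) A)) := by
  have h1 : ∀ i, ((1 + t • A).updateRow i ((1 : Matrix (Fin m) (Fin m) ℝ) i - u • A i)).det
      = (1 + t • A).det - (t + u) * ((1 + t • A).updateRow i (A i)).det := by
    intro i
    have : (1 : Matrix (Fin m) (Fin m) ℝ) i - u • A i
        = (1 + t • A) i + (-(t + u)) • A i := by
      ext j
      simp
      ring
    rw [this, Matrix.det_updateRow_add, Matrix.det_updateRow_smul, Matrix.updateRow_eq_self]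
    ring
  simp_rw [h1]
  rw [Finset.sum_sub_distrib, ← Finset.mul_sum, Finset.sum_const, Finset.card_univ,
    Fintype.card_fin, nsmul_eq_mul, det_one_add_smul_eq_sum, sum_det_updateRow_shape]
  have h2 : t * ∑ k ∈ Finset.range (m + 1), t ^ k * ((k + 1 : ℝ) * sigmaMatrix (k + 1) A)
      = ∑ k ∈ Finset.range (m + 1), t ^ k * (k * sigmaMatrix k A) := by
    rw [Finset.sum_range_succ' (fun k => t ^ k * ((k : ℝ) * sigmaMatrix k A)),
      Finset.sum_range_succ, sigmaMatrix_of_lt (Nat.lt_succ_self m)]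
    simp only [Nat.cast_zero, zero_mul, mul_zero, add_zero]
    rw [Finset.mul_sum]
    refine Finset.sum_congr rfl fun k _ => ?_
    push_cast
    ring
  rw [add_mul, h2, Finset.mul_sum, Finset.mul_sum, ← Finset.sum_add_distrib,
    ← Finset.sum_sub_distrib]
  refine Finset.sum_congr rfl fun k _ => ?_
  ring

/-- `h g⁻¹` has real eigenvalues if `h` is symmetric and `g` is positive definite. -/
theorem splits_charpoly_mul_inv {g h : Matrix (Fin m) (Fin m) ℝ} (hg : g.PosDef)
    (hh : h.IsHermitian) : (h * g⁻¹).charpoly.Splits := by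
  open scoped MatrixOrder in
  obtain ⟨B, hB⟩ := CStarAlgebra.nonneg_iff_eq_star_mul_self.mp hg.inv.posSemidef.nonneg
  -- With $g^{-1}=B^*B$, the product $hB^*B$ has the characteristic polynomial of the Hermitian
  -- matrix $BhB^*$.
  rw [hB, Matrix.star_eq_conjTranspose, ← mul_assoc, Matrix.charpoly_mul_comm, ← mul_assoc]
  exact (Matrix.isHermitian_mul_mul_conjTranspose B hh).splits_charpoly

end MatrixAlgebra

/-! ### The volume form of Euclidean space -/

/-- The determinant as an alternating map on Euclidean space. -/
def volAlt (n : ℕ) : Euc n [⋀^Fin n]→ₗ[ℝ] ℝ :=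
  (Matrix.detRowAlternating : (Fin n → ℝ) [⋀^Fin n]→ₗ[ℝ] ℝ).compLinearMap
    (WithLp.linearEquiv 2 ℝ (Fin n → ℝ)).toLinearMap

theorem volAlt_apply {n : ℕ} (R : Fin n → Euc n) :
    volAlt n R = (Matrix.of fun i j => R i j).det := rfl

/-- The determinant as a continuous multilinear map on Euclidean space. -/
def volCLM (n : ℕ) : ContinuousMultilinearMap ℝ (fun _ : Fin n => Euc n) ℝ where
  toMultilinearMap := (volAlt n).toMultilinearMap
  cont := by
    change Continuous fun R : Fin n → Euc n => (Matrix.of fun i j => R i j).det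
    refine Continuous.matrix_det (continuous_matrix fun i j => ?_)
    simp only [Matrix.of_apply]
    fun_prop

theorem volAlt_mul_volAlt {n : ℕ} (R S : Fin n → Euc n) :
    volAlt n R * volAlt n S = (Matrix.of fun i j => inner ℝ (R i) (S j)).det := by
  rw [volAlt_apply, volAlt_apply, ← Matrix.det_transpose (Matrix.of fun i j => S i j),
    ← Matrix.det_mul]
  congr 1
  ext i j
  simp [Matrix.mul_apply, PiLp.inner_apply, mul_comm]

/-- Pairing $\nu$ with $(\nu,y)$ gives the row $(1,0,\dots,0)$ of the Gram matrix, so expanding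
along it leaves the block of `w` against `y`. The vectors `w` need not be tangent. -/
theorem volAlt_cons_mul_volAlt_cons {m : ℕ} {ν : Euc (m + 1)} {y : Fin m → Euc (m + 1)}
    (hν : ‖ν‖ = 1) (hy : ∀ j, inner ℝ ν (y j) = 0) (w : Fin m → Euc (m + 1)) :
    volAlt (m + 1) (Fin.cons ν w) * volAlt (m + 1) (Fin.cons ν y)
      = (Matrix.of fun i j => inner ℝ (w i) (y j)).det := by
  rw [volAlt_mul_volAlt, Matrix.det_succ_row_zero, Fin.sum_univ_succ]
  simp [hy, hν]
  rfl

theorem eq_zero_of_forall_inner_eq_zero {n : ℕ} {R : Fin n → Euc n} (hR : volAlt n R ≠ 0)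
    {v : Euc n} (hv : ∀ i, inner ℝ (R i) v = 0) : v = 0 := by
  have h : (Matrix.of fun i j => R i j).mulVec v.ofLp = 0 := by
    ext i
    have := hv i
    rw [PiLp.inner_apply] at this
    simpa [Matrix.mulVec, dotProduct, mul_comm] using this
  have := Matrix.eq_zero_of_mulVec_eq_zero hR h
  ext i
  exact congrFun this i

theorem volAlt_eq_zero {n : ℕ} {R : Fin n → Euc n} {v : Euc n} (hv : v ≠ 0)
    (h : ∀ i, inner ℝ (R i) v = 0) : volAlt n R = 0 := by
  by_contra hR
  exact hv (eq_zero_of_forall_inner_eq_zero hR h)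

/-- Exchanging slots $0$ and $i$ costs a sign and puts `P` in slot $0$. Only its component along
$\nu$ survives there: with the remainder of `P`, all $m+1$ vectors are orthogonal to $\nu$, hence
dependent. -/
theorem volAlt_cons_normalDeriv {m : ℕ} {ν P n₁ : Euc (m + 1)} {z : Fin m → Euc (m + 1)}
    (hν : ‖ν‖ = 1) (hz : ∀ j, inner ℝ ν (z j) = 0) (hn : inner ℝ ν n₁ = 0) (i : Fin m) :
    volAlt (m + 1) (Fin.cons n₁ (Function.update z i P))
      = - (inner ℝ P ν * volAlt (m + 1) (Fin.cons ν (Function.update z i n₁))) := by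
  have hswap : volAlt (m + 1) (Fin.cons n₁ (Function.update z i P))
      = - volAlt (m + 1) (Fin.cons P (Function.update z i n₁)) := by
    rw [← (volAlt (m + 1)).map_swap _ (Fin.succ_ne_zero i).symm]
    congr 1
    ext1 j
    refine Fin.cases ?_ (fun l => ?_) j
    · simp [-Fin.cons_update]
    · by_cases hl : l = i
      · subst hl; simp [-Fin.cons_update]
      · simp [-Fin.cons_update, Equiv.swap_apply_of_ne_of_ne (Fin.succ_ne_zero l)
          (fun h => hl (Fin.succ_injective _ h)), hl]
  have hsplit : volAlt (m + 1) (Fin.cons P (Function.update z i n₁))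
      = volAlt (m + 1) (Fin.cons (P - inner ℝ P ν • ν) (Function.update z i n₁))
        + inner ℝ P ν * volAlt (m + 1) (Fin.cons ν (Function.update z i n₁)) := by
    have h1 : ∀ v : Euc (m + 1), (Fin.cons v (Function.update z i n₁) : Fin (m + 1) → Euc (m + 1))
        = Function.update (Fin.cons ν (Function.update z i n₁) : Fin (m + 1) → Euc (m + 1)) 0 v :=
      fun v => (Fin.update_cons_zero _ _ _).symm
    have h2 : inner ℝ P ν * volAlt (m + 1) (Fin.cons ν (Function.update z i n₁))
        = volAlt (m + 1) (Function.update (Fin.cons ν (Function.update z i n₁)) 0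
          ((inner ℝ P ν : ℝ) • ν)) := by
      rw [AlternatingMap.map_update_smul, ← h1 ν, smul_eq_mul]
    rw [h2, h1 P, h1 (P - _), ← AlternatingMap.map_update_add, sub_add_cancel]
  have hzero : volAlt (m + 1) (Fin.cons (P - inner ℝ P ν • ν) (Function.update z i n₁)) = 0 := by
    have hν0 : ν ≠ 0 := by
      rintro rfl
      simp at hν
    refine volAlt_eq_zero hν0 fun j => ?_
    refine Fin.cases ?_ (fun l => ?_) j
    · simp [inner_sub_left, inner_smul_left, hν]
    · by_cases hl : l = i
      · subst hl; simpa [real_inner_comm] using hn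
      · simpa [hl, real_inner_comm] using hz l
  rw [hswap, hsplit, hzero, zero_add]

theorem sum_sum_erase_eq_zero {ι : Type*} [Fintype ι] [DecidableEq ι] {a : ι → ι → ℝ}
    (ha : ∀ i l, i ≠ l → a i l = - a l i) :
    ∑ i, ∑ l ∈ Finset.univ.erase i, a i l = 0 := by
  have h1 : ∀ i, ∑ l ∈ Finset.univ.erase i, a i l = ∑ l, if i = l then 0 else a i l := by
    intro i
    rw [← Finset.sum_erase_add _ _ (Finset.mem_univ i)]
    simp only [if_true, add_zero]
    refine Finset.sum_congr rfl fun l hl => ?_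
    rw [if_neg (Finset.ne_of_mem_erase hl).symm]
  simp_rw [h1]
  have h2 : ∑ i, ∑ l, (if i = l then 0 else a i l)
      = - ∑ i, ∑ l, (if i = l then 0 else a i l) := by
    conv_rhs => rw [Finset.sum_comm]
    rw [← Finset.sum_neg_distrib]
    refine Finset.sum_congr rfl fun i _ => ?_
    rw [← Finset.sum_neg_distrib]
    refine Finset.sum_congr rfl fun l _ => ?_
    by_cases h : i = l
    · simp [h]
    · rw [if_neg h, if_neg (Ne.symm h), ha i l h]
  linarith

/-! ### Divergence of a field of determinants with moving rows. -/

/-- The vector field whose `i`-th component is obtained by inserting `P` in the `i`-th slot. -/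
def slotField {m : ℕ} (N : Euc m → Euc (m + 1)) (z : Fin m → Euc m → Euc (m + 1))
    (P : Euc m → Euc (m + 1)) (i : Fin m) (x : Euc m) : ℝ :=
  volAlt (m + 1) (Fin.cons (N x) (Function.update (fun l => z l x) i (P x)))

theorem hasFDerivAt_slotField {m : ℕ} {N P : Euc m → Euc (m + 1)}
    {z : Fin m → Euc m → Euc (m + 1)} {x : Euc m} (hN : DifferentiableAt ℝ N x)
    (hz : ∀ l, DifferentiableAt ℝ (z l) x) (hP : DifferentiableAt ℝ P x) (i : Fin m) :
    HasFDerivAt (slotField N z P i)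
      (∑ j, ((volCLM (m + 1)).toContinuousLinearMap
        (Fin.cons (N x) (Function.update (fun l => z l x) i (P x))) j) ∘L
          (Fin.cons (fderiv ℝ N x) (Function.update (fun l => fderiv ℝ (z l) x) i (fderiv ℝ P x)) :
            Fin (m + 1) → Euc m →L[ℝ] Euc (m + 1)) j) x := by
  set g : Fin (m + 1) → Euc m → Euc (m + 1) := Fin.cons N (Function.update z i P) with hg
  have hgx : ∀ x', (fun j => g j x')
      = Fin.cons (N x') (Function.update (fun l => z l x') i (P x')) := by
    intro x'
    ext1 j
    refine Fin.cases ?_ (fun l => ?_) j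
    · simp [-Fin.cons_update, hg]
    · by_cases hl : l = i
      · subst hl; simp [-Fin.cons_update, hg]
      · simp [-Fin.cons_update, hg, hl]
  have h : ∀ j, HasFDerivAt (g j) ((Fin.cons (fderiv ℝ N x)
      (Function.update (fun l => fderiv ℝ (z l) x) i (fderiv ℝ P x)) :
            Fin (m + 1) → Euc m →L[ℝ] Euc (m + 1)) j) x := by
    intro j
    refine Fin.cases ?_ (fun l => ?_) j
    · simpa [-Fin.cons_update, hg] using hN.hasFDerivAt
    · by_cases hl : l = i
      · subst hl; simpa [-Fin.cons_update, hg] using hP.hasFDerivAt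
      · simpa [-Fin.cons_update, hg, hl] using (hz l).hasFDerivAt
  have key := HasFDerivAt.multilinear_comp (f := volCLM (m + 1)) h
  simp only [hgx] at key
  exact key

/-- The divergence of `slotField`: the second derivatives cancel by antisymmetry. -/
theorem sum_fderiv_slotField {m : ℕ} {N P : Euc m → Euc (m + 1)}
    {z : Fin m → Euc m → Euc (m + 1)} {x : Euc m} (hN : DifferentiableAt ℝ N x)
    (hz : ∀ l, DifferentiableAt ℝ (z l) x) (hP : DifferentiableAt ℝ P x)
    (hsymm : ∀ i l, partialAt (z l) x i = partialAt (z i) x l)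
    (hν : ‖N x‖ = 1) (hNz : ∀ j, inner ℝ (N x) (z j x) = 0)
    (hNN : ∀ i, inner ℝ (N x) (partialAt N x i) = 0) :
    ∑ i, partialAt (slotField N z P i) x i
      = ∑ i, volAlt (m + 1) (Fin.cons (N x) (Function.update (fun l => z l x) i
          (partialAt P x i - (inner ℝ (P x) (N x) : ℝ) • partialAt N x i))) := by
  set Z : Fin m → Euc (m + 1) := fun l => z l x with hZ
  -- `a i l` is the term of the $i$-th summand in which the derivative falls on $z_l$, $l\ne i$.
  set a : Fin m → Fin m → ℝ := fun i l => volAlt (m + 1) (Fin.cons (N x)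
    (Function.update (Function.update Z i (P x)) l (partialAt (z l) x i))) with ha
  have hlin : ∀ (i : Fin m) (v w : Euc (m + 1)) (c : ℝ),
      volAlt (m + 1) (Fin.cons (N x) (Function.update Z i (v - c • w)))
      = volAlt (m + 1) (Fin.cons (N x) (Function.update Z i v))
        - c * volAlt (m + 1) (Fin.cons (N x) (Function.update Z i w)) := by
    intro i v w c
    simp only [Fin.cons_update]
    rw [AlternatingMap.map_update_sub, AlternatingMap.map_update_smul, smul_eq_mul]
  have hder : ∀ i, partialAt (slotField N z P i) x i
      = volAlt (m + 1) (Fin.cons (N x) (Function.update Z i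
          (partialAt P x i - (inner ℝ (P x) (N x) : ℝ) • partialAt N x i)))
        + ∑ l ∈ Finset.univ.erase i, a i l := by
    intro i
    rw [hlin, partialAt, (hasFDerivAt_slotField hN hz hP i).fderiv, sum_apply,
      Fin.sum_univ_succ, ← Finset.add_sum_erase _ _ (Finset.mem_univ i)]
    have h0 : ∀ (v : Euc (m + 1)) (j : Fin (m + 1)) (R : Fin (m + 1) → Euc (m + 1)),
        (volCLM (m + 1)).toContinuousLinearMap R j v
          = volAlt (m + 1) (Function.update R j v) := fun _ _ _ => rfl
    simp only [ContinuousLinearMap.comp_apply, h0, Fin.cons_zero, Fin.update_cons_zero,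
      Fin.cons_succ, ← Fin.cons_update, Function.update_self, Function.update_idem]
    have h1 := volAlt_cons_normalDeriv (P := P x) hν hNz (hNN i) i
    rw [partialAt] at h1
    rw [h1]
    have h2 : ∀ l ∈ Finset.univ.erase i, volAlt (m + 1) (Fin.cons (N x)
        (Function.update (Function.update Z i (P x)) l
          ((Function.update (fun l => fderiv ℝ (z l) x) i (fderiv ℝ P x)) l
            (EuclideanSpace.single i 1)))) = a i l := by
      intro l hl
      rw [Function.update_of_ne (Finset.ne_of_mem_erase hl)]
      rfl
    rw [Finset.sum_congr rfl h2]
    simp only [partialAt]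
    ring
  simp_rw [hder]
  rw [Finset.sum_add_distrib, sum_sum_erase_eq_zero, add_zero]
  intro i l hil
  simp only [ha]
  -- As $\partial_iz_l=\partial_lz_i$, the terms `a i l` and `a l i` contain the same vectors, with
  -- `P` and this derivative exchanged between slots $i$ and $l$.
  rw [hsymm i l, ← (volAlt (m + 1)).map_swap _
    (show (i.succ : Fin (m + 1)) ≠ l.succ from fun h => hil (Fin.succ_injective _ h))]
  congr 1
  ext1 j
  refine Fin.cases ?_ (fun p => ?_) j
  · simp [-Fin.cons_update, Equiv.swap_apply_of_ne_of_ne (Fin.succ_ne_zero i).symm (Fin.succ_ne_zero l).symm]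
  · by_cases hp : p = i
    · subst hp
      simp [-Fin.cons_update, Ne.symm hil, hil]
    · by_cases hp' : p = l
      · subst hp'
        simp [-Fin.cons_update]
      · simp [-Fin.cons_update, Equiv.swap_apply_of_ne_of_ne (fun h => hp (Fin.succ_injective _ h))
          (fun h => hp' (Fin.succ_injective _ h)), hp, hp']

/-! ### Hypersurfaces in local coordinates -/

/-- `Y` is a smooth immersion on the open set `U`, with smooth unit normal field `N`. -/
structure IsLocalHypersurface {m : ℕ} (U : Set (Euc m)) (Y N : Euc m → Euc (m + 1)) : Prop where
  isOpen : IsOpen U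
  smooth : ContDiffOn ℝ ∞ Y U
  smooth_normal : ContDiffOn ℝ ∞ N U
  norm_normal : ∀ x ∈ U, ‖N x‖ = 1
  normal : ∀ x ∈ U, ∀ i, inner ℝ (N x) (partialAt Y x i) = 0
  linearIndependent : ∀ x ∈ U, LinearIndependent ℝ (partialAt Y x)

theorem contDiffOn_partialAt {m : ℕ} {F : Type*} [NormedAddCommGroup F] [NormedSpace ℝ F]
    {f : Euc m → F} {U : Set (Euc m)} (hf : ContDiffOn ℝ ∞ f U) (hU : IsOpen U) (i : Fin m) :
    ContDiffOn ℝ ∞ (fun x => partialAt f x i) U :=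
  (hf.fderiv_of_isOpen hU le_rfl).clm_apply contDiffOn_const

theorem _root_.ContDiffOn.differentiableAt_of_isOpen {m : ℕ} {F : Type*} [NormedAddCommGroup F]
    [NormedSpace ℝ F] {f : Euc m → F} {U : Set (Euc m)} (hf : ContDiffOn ℝ ∞ f U) (hU : IsOpen U)
    {x : Euc m} (hx : x ∈ U) : DifferentiableAt ℝ f x :=
  (hf.contDiffAt (hU.mem_nhds hx)).differentiableAt (by simp)

theorem partialAt_inner {m n : ℕ} {f g : Euc m → Euc n} {x : Euc m}
    (hf : DifferentiableAt ℝ f x) (hg : DifferentiableAt ℝ g x) (i : Fin m) :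
    partialAt (fun x => (inner ℝ (f x) (g x) : ℝ)) x i
      = inner ℝ (f x) (partialAt g x i) + inner ℝ (partialAt f x i) (g x) :=
  fderiv_inner_apply ℝ hf hg _

theorem partialAt_congr {m : ℕ} {F : Type*} [NormedAddCommGroup F] [NormedSpace ℝ F]
    {f g : Euc m → F} {x : Euc m} (h : f =ᶠ[nhds x] g) (i : Fin m) :
    partialAt f x i = partialAt g x i := by
  rw [partialAt, partialAt, h.fderiv_eq]

theorem partialAt_partialAt_comm {m : ℕ} {F : Type*} [NormedAddCommGroup F] [NormedSpace ℝ F]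
    {f : Euc m → F} {U : Set (Euc m)} (hf : ContDiffOn ℝ ∞ f U) (hU : IsOpen U)
    {x : Euc m} (hx : x ∈ U) (i j : Fin m) :
    partialAt (fun x => partialAt f x i) x j = partialAt (fun x => partialAt f x j) x i := by
  have hd : DifferentiableAt ℝ (fderiv ℝ f) x :=
    (hf.fderiv_of_isOpen hU (m := ∞) le_rfl).differentiableAt_of_isOpen hU hx
  have h : ∀ i j : Fin m, partialAt (fun x => partialAt f x i) x j
      = fderiv ℝ (fderiv ℝ f) x (EuclideanSpace.single j 1) (EuclideanSpace.single i 1) := by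
    intro i j
    simp only [partialAt]
    rw [fderiv_clm_apply hd (differentiableAt_const _)]
    simp
  rw [h, h]
  have hs : IsSymmSndFDerivAt ℝ f x :=
    (hf.contDiffAt (hU.mem_nhds hx)).isSymmSndFDerivAt (by simp; exact WithTop.coe_le_coe.2 le_top)
  exact hs.eq _ _

theorem transpose_metricCoeff {m n : ℕ} (Y : Euc m → Euc n) (x : Euc m) :
    (metricCoeff Y x).transpose = metricCoeff Y x := by
  ext i j
  simp [metricCoeff, real_inner_comm]

theorem shapeCoeff_eq_mul_inv {m n : ℕ} (Y N : Euc m → Euc n) (x : Euc m) :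
    shapeCoeff Y N x = sffCoeff Y N x * (metricCoeff Y x)⁻¹ := by
  ext i j
  have h : ∀ l, (metricCoeff Y x)⁻¹ j l = (metricCoeff Y x)⁻¹ l j := by
    intro l
    conv_lhs => rw [← transpose_metricCoeff, ← Matrix.transpose_nonsing_inv,
      Matrix.transpose_apply]
  simp [shapeCoeff, Matrix.mul_apply, h, mul_comm]

/-- `(T_k)^{ij} ∂_i f ∂_j w` in local coordinates. -/
def localForm {m n : ℕ} (k : ℕ) (Y N : Euc m → Euc n) (f w : Euc m → ℝ) (x : Euc m) : ℝ :=
  newtonForm k (shapeCoeff Y N x) (partialAt f x)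
    ((metricCoeff Y x)⁻¹.mulVec (partialAt w x))

theorem sum_newtonUpper_mul {m n : ℕ} (k : ℕ) (Y N : Euc m → Euc n) (x : Euc m)
    (a b : Fin m → ℝ) :
    ∑ i, ∑ j, newtonUpper k Y N x i j * a i * b j
      = newtonForm k (shapeCoeff Y N x) a ((metricCoeff Y x)⁻¹.mulVec b) := by
  refine Finset.sum_congr rfl fun i _ => ?_
  simp only [newtonUpper, Matrix.of_apply, Finset.sum_mul, Matrix.mulVec, dotProduct,
    Finset.mul_sum]
  rw [Finset.sum_comm]
  refine Finset.sum_congr rfl fun j _ => Finset.sum_congr rfl fun l _ => ?_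
  ring

theorem newtonForm_smul_left {m : ℕ} (k : ℕ) (A : Matrix (Fin m) (Fin m) ℝ) (r : ℝ)
    (v c : Fin m → ℝ) : newtonForm k A (r • v) c = r * newtonForm k A v c := by
  simp only [newtonForm, Finset.mul_sum, Pi.smul_apply, smul_eq_mul]
  refine Finset.sum_congr rfl fun i _ => Finset.sum_congr rfl fun j _ => ?_
  ring

theorem newtonForm_smul_right {m : ℕ} (k : ℕ) (A : Matrix (Fin m) (Fin m) ℝ) (r : ℝ)
    (v c : Fin m → ℝ) : newtonForm k A v (r • c) = r * newtonForm k A v c := by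
  simp only [newtonForm, Finset.mul_sum, Pi.smul_apply, smul_eq_mul]
  refine Finset.sum_congr rfl fun i _ => Finset.sum_congr rfl fun j _ => ?_
  ring

namespace IsLocalHypersurface

variable {m : ℕ} {U : Set (Euc m)} {Y N : Euc m → Euc (m + 1)} (hY : IsLocalHypersurface U Y N)
include hY

theorem posDef_metricCoeff {x : Euc m} (hx : x ∈ U) : (metricCoeff Y x).PosDef :=
  Matrix.posDef_gram_of_linearIndependent (hY.linearIndependent x hx)

theorem det_metricCoeff_pos {x : Euc m} (hx : x ∈ U) : 0 < (metricCoeff Y x).det :=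
  (hY.posDef_metricCoeff hx).det_pos

theorem inner_normal_partialAt_normal {x : Euc m} (hx : x ∈ U) (i : Fin m) :
    inner ℝ (N x) (partialAt N x i) = 0 := by
  have hd := hY.smooth_normal.differentiableAt_of_isOpen hY.isOpen hx
  have h1 := partialAt_inner hd hd i
  have h2 : (fun x => (inner ℝ (N x) (N x) : ℝ)) =ᶠ[nhds x] fun _ => 1 := by
    filter_upwards [hY.isOpen.mem_nhds hx] with x' hx'
    rw [real_inner_self_eq_norm_sq, hY.norm_normal x' hx', one_pow]
  rw [partialAt_congr h2, real_inner_comm (N x)] at h1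
  have h3 : partialAt (fun _ : Euc m => (1 : ℝ)) x i = 0 := by simp [partialAt]
  linarith

/-- Obtained by differentiating $\langle N,\partial_jY\rangle=0$. Symmetry of $h$ then reduces to
equality of mixed partials. -/
theorem sffCoeff_eq_neg {x : Euc m} (hx : x ∈ U) (i j : Fin m) :
    sffCoeff Y N x i j = - inner ℝ (N x) (partialAt (fun x => partialAt Y x j) x i) := by
  have hd := hY.smooth_normal.differentiableAt_of_isOpen hY.isOpen hx
  have hd' := (contDiffOn_partialAt hY.smooth hY.isOpen j).differentiableAt_of_isOpen hY.isOpen hx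
  have h1 := partialAt_inner hd hd' i
  have h2 : (fun x => (inner ℝ (N x) (partialAt Y x j) : ℝ)) =ᶠ[nhds x] fun _ => 0 := by
    filter_upwards [hY.isOpen.mem_nhds hx] with x' hx'
    exact hY.normal x' hx' j
  rw [partialAt_congr h2] at h1
  have h3 : partialAt (fun _ : Euc m => (0 : ℝ)) x i = 0 := by simp [partialAt]
  simp only [sffCoeff, Matrix.of_apply]
  linarith

theorem isHermitian_sffCoeff {x : Euc m} (hx : x ∈ U) : (sffCoeff Y N x).IsHermitian := by
  ext i j
  rw [Matrix.conjTranspose_apply, star_trivial, hY.sffCoeff_eq_neg hx, hY.sffCoeff_eq_neg hx,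
    partialAt_partialAt_comm hY.smooth hY.isOpen hx]

theorem splits_charpoly_shapeCoeff {x : Euc m} (hx : x ∈ U) :
    (shapeCoeff Y N x).charpoly.Splits := by
  rw [shapeCoeff_eq_mul_inv]
  exact splits_charpoly_mul_inv (hY.posDef_metricCoeff hx) (hY.isHermitian_sffCoeff hx)

theorem isUnit_det_metricCoeff {x : Euc m} (hx : x ∈ U) : IsUnit (metricCoeff Y x).det :=
  (hY.det_metricCoeff_pos hx).ne'.isUnit

theorem shapeCoeff_mul_metricCoeff {x : Euc m} (hx : x ∈ U) :
    shapeCoeff Y N x * metricCoeff Y x = sffCoeff Y N x := by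
  rw [shapeCoeff_eq_mul_inv, mul_assoc, Matrix.nonsing_inv_mul _ (hY.isUnit_det_metricCoeff hx),
    mul_one]

theorem sq_volAlt {x : Euc m} (hx : x ∈ U) :
    volAlt (m + 1) (Fin.cons (N x) (partialAt Y x)) ^ 2 = (metricCoeff Y x).det := by
  rw [sq, volAlt_cons_mul_volAlt_cons (hY.norm_normal x hx) (hY.normal x hx)]
  rfl

theorem volAlt_ne_zero {x : Euc m} (hx : x ∈ U) :
    volAlt (m + 1) (Fin.cons (N x) (partialAt Y x)) ≠ 0 := by
  intro h
  have := hY.sq_volAlt hx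
  rw [h] at this
  have := hY.det_metricCoeff_pos hx
  simp_all

/-- Gram matrices against $\partial Y$ determine the determinant: after multiplication by the
nonzero $\det(N,\partial Y)$, whose square is $\det g$, both sides are determinants of such
matrices. -/
theorem volAlt_cons_eq {x : Euc m} (hx : x ∈ U) {w : Fin m → Euc (m + 1)}
    {B : Matrix (Fin m) (Fin m) ℝ}
    (h : (Matrix.of fun i j => inner ℝ (w i) (partialAt Y x j)) = B * metricCoeff Y x) :
    volAlt (m + 1) (Fin.cons (N x) w)
      = B.det * volAlt (m + 1) (Fin.cons (N x) (partialAt Y x)) := by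
  have h1 := volAlt_cons_mul_volAlt_cons (hY.norm_normal x hx) (hY.normal x hx) w
  rw [h, Matrix.det_mul, ← hY.sq_volAlt hx, sq, ← mul_assoc] at h1
  exact mul_right_cancel₀ (hY.volAlt_ne_zero hx) h1

/-- The difference of the two sides is orthogonal to the basis formed by `N` and the $\partial_jY$.
-/
theorem weingarten {x : Euc m} (hx : x ∈ U) (i : Fin m) :
    partialAt N x i = ∑ l, shapeCoeff Y N x i l • partialAt Y x l := by
  rw [← sub_eq_zero]
  refine eq_zero_of_forall_inner_eq_zero (hY.volAlt_ne_zero hx) fun j => ?_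
  refine Fin.cases ?_ (fun j => ?_) j
  · simp [inner_sub_right, inner_sum, inner_smul_right, hY.inner_normal_partialAt_normal hx,
      hY.normal x hx]
  · have h := congrFun (congrFun (hY.shapeCoeff_mul_metricCoeff hx) i) j
    rw [Matrix.mul_apply] at h
    simp only [Fin.cons_succ, inner_sub_right, inner_sum, inner_smul_right, sub_eq_zero]
    rw [real_inner_comm]
    refine Eq.trans h.symm ?_
    refine Finset.sum_congr rfl fun l _ => ?_
    simp [metricCoeff, real_inner_comm]

/-- $\sqrt{\det g}=|\det(N,\partial Y)|$, and this determinant is continuous and nonzero, so its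
sign $s$ is constant near $x$. The density can thus be differentiated as a determinant, whichever
way the chart is oriented. -/
theorem exists_sqrt_det_eq {x : Euc m} (hx : x ∈ U) :
    ∃ s : ℝ, ∀ᶠ x' in nhds x, Real.sqrt (metricCoeff Y x').det
      = s * volAlt (m + 1) (Fin.cons (N x') (partialAt Y x')) := by
  have hc : ContinuousAt (fun x' => volAlt (m + 1) (Fin.cons (N x') (partialAt Y x'))) x := by
    refine ContinuousAt.comp (f := fun x' => (Fin.cons (N x') (partialAt Y x') :
      Fin (m + 1) → Euc (m + 1))) (volCLM (m + 1)).cont.continuousAt ?_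
    refine continuousAt_pi.2 fun j => ?_
    refine Fin.cases ?_ (fun j => ?_) j
    · simpa using (hY.smooth_normal.differentiableAt_of_isOpen hY.isOpen hx).continuousAt
    · simpa using ((contDiffOn_partialAt hY.smooth hY.isOpen j).differentiableAt_of_isOpen
        hY.isOpen hx).continuousAt
  rcases lt_or_gt_of_ne (hY.volAlt_ne_zero hx) with h | h
  · refine ⟨-1, ?_⟩
    filter_upwards [hY.isOpen.mem_nhds hx, hc.eventually (gt_mem_nhds h)] with x' hx' h'
    rw [← hY.sq_volAlt hx', Real.sqrt_sq_eq_abs, abs_of_neg h', neg_one_mul]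
  · refine ⟨1, ?_⟩
    filter_upwards [hY.isOpen.mem_nhds hx, hc.eventually (lt_mem_nhds h)] with x' hx' h'
    rw [← hY.sq_volAlt hx', Real.sqrt_sq_eq_abs, abs_of_pos h', one_mul]

end IsLocalHypersurface

/-! ### The Newton field in a chart: divergence and integration by parts. -/

/-- A function continuous on an open set times a continuous compactly supported function whose
support lies in the open set is integrable. -/
theorem integrable_mul_of_tsupport_subset {E : Type*} [TopologicalSpace E] [MeasurableSpace E]
    [OpensMeasurableSpace E] {μ : Measure E} [IsFiniteMeasureOnCompacts μ] {U : Set E}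
    (hU : IsOpen U) {φ G : E → ℝ} (hφ : Continuous φ) (hc : HasCompactSupport φ)
    (hs : tsupport φ ⊆ U) (hG : ContinuousOn G U) : Integrable (fun x => φ x * G x) μ := by
  have hcont : Continuous fun x => φ x * G x := by
    refine continuous_of_tsupport fun x hx => ?_
    have hx' : x ∈ U := hs (tsupport_mul_subset_left hx)
    exact hφ.continuousAt.mul (hG.continuousAt (hU.mem_nhds hx'))
  exact hcont.integrable_of_hasCompactSupport hc.mul_right

/-- The tangential part of the position vector in local coordinates. -/
def posCoeff {m n : ℕ} (O : Euc n) (Y : Euc m → Euc n) (x : Euc m) : Fin m → ℝ :=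
  (metricCoeff Y x)⁻¹.mulVec fun j => inner ℝ (Y x - O) (partialAt Y x j)

/-- The vector field `√(det g) ∑_k t^k (T_k)^{ij} ∂_j (r² / 2)` in local coordinates. -/
def newtonField {m n : ℕ} (t : ℝ) (O : Euc n) (Y N : Euc m → Euc n) (i : Fin m) (x : Euc m) : ℝ :=
  Real.sqrt (metricCoeff Y x).det
    * ((1 + t • shapeCoeff Y N x).updateRow i (posCoeff O Y x)).det

/-- The partial derivatives of the parallel hypersurface `Y + t N`. -/
def parallelFrame {m n : ℕ} (t : ℝ) (Y N : Euc m → Euc n) (l : Fin m) (x : Euc m) : Euc n :=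
  partialAt Y x l + t • partialAt N x l

theorem partialAt_sub_const {m n : ℕ} (O : Euc n) (Y : Euc m → Euc n) (x : Euc m) (i : Fin m) :
    partialAt (fun x => Y x - O) x i = partialAt Y x i := by
  simp [partialAt, fderiv_sub_const]

namespace IsLocalHypersurface

variable {m : ℕ} {U : Set (Euc m)} {Y N : Euc m → Euc (m + 1)} (hY : IsLocalHypersurface U Y N)
include hY

theorem gram_parallelFrame (t : ℝ) {x : Euc m} (hx : x ∈ U) :
    (Matrix.of fun i j => inner ℝ (parallelFrame t Y N i x) (partialAt Y x j))
      = (1 + t • shapeCoeff Y N x) * metricCoeff Y x := by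
  rw [add_mul, one_mul, Matrix.smul_mul, hY.shapeCoeff_mul_metricCoeff hx]
  ext i j
  simp [parallelFrame, inner_add_left, inner_smul_left, metricCoeff, sffCoeff]

/-- Only the tangential part `r` of `v` matters, since `N` already fills slot $0$. It applies to
$v=Y-O$, giving the field, and to $v=\partial_iY-u\,\partial_iN$, giving its divergence. -/
theorem volAlt_update_parallelFrame (t : ℝ) {x : Euc m} (hx : x ∈ U) (i : Fin m)
    {v : Euc (m + 1)} {r : Fin m → ℝ}
    (h : ∀ j, inner ℝ v (partialAt Y x j) = ∑ l, r l * metricCoeff Y x l j) :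
    volAlt (m + 1) (Fin.cons (N x) (Function.update (fun l => parallelFrame t Y N l x) i v))
      = ((1 + t • shapeCoeff Y N x).updateRow i r).det
        * volAlt (m + 1) (Fin.cons (N x) (partialAt Y x)) := by
  refine hY.volAlt_cons_eq hx ?_
  ext a j
  by_cases ha : a = i
  · subst ha
    simp [Matrix.mul_apply, h]
  · have := congrFun (congrFun (hY.gram_parallelFrame t hx) a) j
    rw [Matrix.mul_apply] at this ⊢
    simpa [Matrix.updateRow_ne ha, ha] using this

theorem sum_posCoeff_mul (O : Euc (m + 1)) {x : Euc m} (hx : x ∈ U) (j : Fin m) :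
    inner ℝ (Y x - O) (partialAt Y x j) = ∑ l, posCoeff O Y x l * metricCoeff Y x l j := by
  have h : (metricCoeff Y x).mulVec (posCoeff O Y x)
      = fun j => inner ℝ (Y x - O) (partialAt Y x j) := by
    rw [posCoeff, Matrix.mulVec_mulVec, Matrix.mul_nonsing_inv _ (hY.isUnit_det_metricCoeff hx),
      Matrix.one_mulVec]
  have := congrFun h j
  refine this.symm.trans ?_
  change ∑ l, metricCoeff Y x j l * posCoeff O Y x l = _
  refine Finset.sum_congr rfl fun l _ => ?_
  rw [mul_comm, ← Matrix.transpose_apply (metricCoeff Y x), transpose_metricCoeff]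

theorem slotField_eq (t : ℝ) (O : Euc (m + 1)) {x : Euc m} (hx : x ∈ U) (i : Fin m) :
    slotField N (parallelFrame t Y N) (fun x => Y x - O) i x
      = ((1 + t • shapeCoeff Y N x).updateRow i (posCoeff O Y x)).det
        * volAlt (m + 1) (Fin.cons (N x) (partialAt Y x)) :=
  hY.volAlt_update_parallelFrame t hx i (hY.sum_posCoeff_mul O hx)

theorem exists_newtonField_eventuallyEq (t : ℝ) (O : Euc (m + 1)) {x : Euc m} (hx : x ∈ U) :
    ∃ s : ℝ, Real.sqrt (metricCoeff Y x).det
        = s * volAlt (m + 1) (Fin.cons (N x) (partialAt Y x)) ∧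
      ∀ i, newtonField t O Y N i
        =ᶠ[nhds x] fun x' => s * slotField N (parallelFrame t Y N) (fun x => Y x - O) i x' := by
  obtain ⟨s, hs⟩ := hY.exists_sqrt_det_eq hx
  refine ⟨s, hs.self_of_nhds, fun i => ?_⟩
  filter_upwards [hs, hY.isOpen.mem_nhds hx] with x' h1 h2
  rw [hY.slotField_eq t O h2, newtonField, h1]
  ring

theorem contDiffOn_parallelFrame (t : ℝ) (l : Fin m) : ContDiffOn ℝ ∞ (parallelFrame t Y N l) U :=
  (contDiffOn_partialAt hY.smooth hY.isOpen l).add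
    ((contDiffOn_partialAt hY.smooth_normal hY.isOpen l).const_smul t)

theorem contDiffOn_slotField (t : ℝ) (O : Euc (m + 1)) (i : Fin m) :
    ContDiffOn ℝ ∞ (slotField N (parallelFrame t Y N) (fun x => Y x - O) i) U := by
  refine ContDiff.comp_contDiffOn (g := volCLM (m + 1)) (volCLM (m + 1)).contDiff
    (f := fun x => (Fin.cons (N x) (Function.update (fun l => parallelFrame t Y N l x) i (Y x - O)) :
      Fin (m + 1) → Euc (m + 1))) ?_
  refine contDiffOn_pi.2 fun j => ?_
  refine Fin.cases ?_ (fun l => ?_) j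
  · simpa only [Fin.cons_zero] using hY.smooth_normal
  · by_cases hl : l = i
    · subst hl
      simpa only [Fin.cons_succ, Function.update_self] using hY.smooth.sub contDiffOn_const
    · simpa only [Fin.cons_succ, Function.update_of_ne hl] using hY.contDiffOn_parallelFrame t l

theorem contDiffOn_newtonField (t : ℝ) (O : Euc (m + 1)) (i : Fin m) :
    ContDiffOn ℝ ∞ (newtonField t O Y N i) U := by
  intro x hx
  obtain ⟨s, -, hs⟩ := hY.exists_newtonField_eventuallyEq t O hx
  have h := ((hY.contDiffOn_slotField t O i).contDiffAt (hY.isOpen.mem_nhds hx)).const_smul s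
  exact (h.congr_of_eventuallyEq (hs i)).contDiffWithinAt

/-- The divergence formula for the generating function of the Newton tensors. -/
theorem sum_partialAt_newtonField (t : ℝ) (O : Euc (m + 1)) {x : Euc m} (hx : x ∈ U) :
    ∑ i, partialAt (newtonField t O Y N i) x i
      = Real.sqrt (metricCoeff Y x).det * ∑ k ∈ Finset.range (m + 1), t ^ k *
          (((m : ℝ) - k) * sigmaMatrix k (shapeCoeff Y N x)
          - inner ℝ (Y x - O) (N x) * ((k + 1 : ℝ) * sigmaMatrix (k + 1) (shapeCoeff Y N x))) := by
  obtain ⟨s, hs0, hs⟩ := hY.exists_newtonField_eventuallyEq t O hx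
  have hdN := hY.smooth_normal.differentiableAt_of_isOpen hY.isOpen hx
  have hdY := hY.smooth.differentiableAt_of_isOpen hY.isOpen hx
  have hdz := fun l => (hY.contDiffOn_parallelFrame t l).differentiableAt_of_isOpen hY.isOpen hx
  have h1 : ∀ i, partialAt (newtonField t O Y N i) x i
      = s * partialAt (slotField N (parallelFrame t Y N) (fun x => Y x - O) i) x i := by
    intro i
    rw [partialAt_congr (hs i), partialAt, fderiv_const_mul
      ((hY.contDiffOn_slotField t O i).differentiableAt_of_isOpen hY.isOpen hx)]
    rfl
  -- The frame consists of the partial derivatives of the single map $Y+tN$; this symmetry plays the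
  -- role of the Codazzi equations.
  have hsymm : ∀ i l, partialAt (parallelFrame t Y N l) x i
      = partialAt (parallelFrame t Y N i) x l := by
    have h : ∀ i l, partialAt (parallelFrame t Y N l) x i
        = partialAt (fun x => partialAt Y x l) x i
          + t • partialAt (fun x => partialAt N x l) x i := by
      intro i l
      have a1 := (contDiffOn_partialAt hY.smooth hY.isOpen l).differentiableAt_of_isOpen
        hY.isOpen hx
      have a2 := (contDiffOn_partialAt hY.smooth_normal hY.isOpen l).differentiableAt_of_isOpen
        hY.isOpen hx
      have a3 := (a1.hasFDerivAt.add (a2.hasFDerivAt.const_smul t)).fderiv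
      exact congrArg (fun L => L (EuclideanSpace.single i 1)) a3
    intro i l
    rw [h, h, partialAt_partialAt_comm hY.smooth hY.isOpen hx,
      partialAt_partialAt_comm hY.smooth_normal hY.isOpen hx]
  have hperp : ∀ j, inner ℝ (N x) (parallelFrame t Y N j x) = 0 := by
    intro j
    simp [parallelFrame, inner_add_right, inner_smul_right, hY.normal x hx,
      hY.inner_normal_partialAt_normal hx]
  simp_rw [h1]
  rw [← Finset.mul_sum, sum_fderiv_slotField hdN hdz (hdY.sub_const O) hsymm (hY.norm_normal x hx)
    hperp (hY.inner_normal_partialAt_normal hx)]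
  rw [← sum_det_updateRow_trace, hs0, mul_assoc]
  congr 1
  rw [Finset.mul_sum]
  refine Finset.sum_congr rfl fun i _ => ?_
  rw [mul_comm (volAlt _ _)]
  -- By Weingarten's relation, $\partial_iY-u\,\partial_iN$ has coefficient row $e_i-uA_i$ in the
  -- frame $\partial_lY$.
  refine hY.volAlt_update_parallelFrame t hx i fun j => ?_
  have h := congrFun (congrFun (hY.shapeCoeff_mul_metricCoeff hx) i) j
  rw [Matrix.mul_apply] at h
  rw [partialAt_sub_const]
  simp only [Pi.sub_apply, Pi.smul_apply, smul_eq_mul, sub_mul, Finset.sum_sub_distrib,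
    mul_assoc, ← Finset.mul_sum, h]
  simp [inner_sub_left, inner_smul_left, Matrix.one_apply, metricCoeff, sffCoeff]

/-- The field is smooth only on `U`. This suffices: its differentiability is needed only on the
closed support of `φ`, and every product with `φ` or its derivatives is continuous with compact
support. -/
theorem integral_mul_divergence (t : ℝ) (O : Euc (m + 1)) {φ : Euc m → ℝ} (hφ : ContDiff ℝ 1 φ)
    (hc : HasCompactSupport φ) (hs : tsupport φ ⊆ U) :
    ∫ x, φ x * ∑ i, partialAt (newtonField t O Y N i) x i
      = - ∫ x, ∑ i, partialAt φ x i * newtonField t O Y N i x := by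
  have hW := fun i => hY.contDiffOn_newtonField t O i
  have hWc := fun i => (hW i).continuousOn
  have hdφ : ∀ i, Continuous fun x => partialAt φ x i := fun i =>
    (hφ.continuous_fderiv (by simp)).clm_apply continuous_const
  have hts : ∀ i, tsupport (fun x => partialAt φ x i) ⊆ tsupport φ := fun i =>
    tsupport_fderiv_apply_subset ℝ _
  have i1 : ∀ i, Integrable fun x => partialAt φ x i * newtonField t O Y N i x := fun i =>
    integrable_mul_of_tsupport_subset hY.isOpen (hdφ i)
      (hc.of_isClosed_subset (isClosed_tsupport _) (hts i)) ((hts i).trans hs) (hWc i)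
  have i2 : ∀ i, Integrable fun x => φ x * partialAt (newtonField t O Y N i) x i := fun i =>
    integrable_mul_of_tsupport_subset hY.isOpen hφ.continuous hc hs
      (contDiffOn_partialAt (hW i) hY.isOpen i).continuousOn
  have i3 : ∀ i, Integrable fun x => φ x * newtonField t O Y N i x := fun i =>
    integrable_mul_of_tsupport_subset hY.isOpen hφ.continuous hc hs (hWc i)
  simp_rw [Finset.mul_sum]
  rw [integral_finsetSum _ fun i _ => i2 i, integral_finsetSum _ fun i _ => i1 i,
    ← Finset.sum_neg_distrib]
  refine Finset.sum_congr rfl fun i _ => ?_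
  exact integral_mul_fderiv_eq_neg_fderiv_mul_of_integrable (i1 i) (i2 i) (i3 i)
    (fun x _ => (hφ.differentiable (by simp)).differentiableAt)
    (fun x hx => (hW i).differentiableAt_of_isOpen hY.isOpen (hs hx))

theorem partialAt_distSq (O : Euc (m + 1)) {x : Euc m} (hx : x ∈ U) (i : Fin m) :
    partialAt (fun x => dist (Y x) O ^ 2) x i = 2 * inner ℝ (Y x - O) (partialAt Y x i) := by
  have hd := (hY.smooth.differentiableAt_of_isOpen hY.isOpen hx).sub_const O
  have h1 := partialAt_inner hd hd i
  have h2 : (fun x => dist (Y x) O ^ 2) = fun x => (inner ℝ (Y x - O) (Y x - O) : ℝ) := by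
    ext1 x
    rw [real_inner_self_eq_norm_sq, dist_eq_norm]
  rw [h2, h1, real_inner_comm (Y x - O), partialAt_sub_const]
  ring

theorem localForm_distSq (k : ℕ) (O : Euc (m + 1)) (f : Euc m → ℝ) {x : Euc m} (hx : x ∈ U) :
    localForm k Y N f (fun x => dist (Y x) O ^ 2) x
      = 2 * newtonForm k (shapeCoeff Y N x) (partialAt f x) (posCoeff O Y x) := by
  have : partialAt (fun x => dist (Y x) O ^ 2) x
      = (2 : ℝ) • fun i => inner ℝ (Y x - O) (partialAt Y x i) := by
    ext i
    exact hY.partialAt_distSq O hx i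
  rw [localForm, this, Matrix.mulVec_smul, newtonForm_smul_right]
  rfl

/-- The term $\langle\partial_iY,N\rangle$ vanishes and Weingarten's relation handles $\langle
Y-O,\partial_iN\rangle$. This is the source of the factor $h_i^l$ in the second formula. -/
theorem partialAt_support (O : Euc (m + 1)) {x : Euc m} (hx : x ∈ U) :
    partialAt (fun x => (inner ℝ (Y x - O) (N x) : ℝ)) x
      = (1 / 2 : ℝ) • (shapeCoeff Y N x).mulVec (partialAt (fun x => dist (Y x) O ^ 2) x) := by
  ext i
  have hd := (hY.smooth.differentiableAt_of_isOpen hY.isOpen hx).sub_const O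
  have hdN := hY.smooth_normal.differentiableAt_of_isOpen hY.isOpen hx
  rw [partialAt_inner hd hdN, partialAt_sub_const, real_inner_comm (N x), hY.normal x hx,
    hY.weingarten hx]
  simp only [inner_sum, inner_smul_right, Pi.smul_apply, Matrix.mulVec, dotProduct, smul_eq_mul,
    hY.partialAt_distSq O hx, Finset.mul_sum, add_zero]
  refine Finset.sum_congr rfl fun l _ => ?_
  ring

/-- The integral formula in local coordinates, for test functions with compact support. -/
theorem integral_localForm_distSq (t : ℝ) (O : Euc (m + 1)) {φ : Euc m → ℝ} (hφ : ContDiff ℝ 1 φ)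
    (hc : HasCompactSupport φ) (hs : tsupport φ ⊆ U) :
    ∫ x in U, Real.sqrt (metricCoeff Y x).det * (φ x * ∑ k ∈ Finset.range (m + 1), t ^ k *
          (((m : ℝ) - k) * sigmaMatrix k (shapeCoeff Y N x)
          - inner ℝ (Y x - O) (N x) * ((k + 1 : ℝ) * sigmaMatrix (k + 1) (shapeCoeff Y N x))))
      = ∫ x in U, Real.sqrt (metricCoeff Y x).det * (-(1 / 2 : ℝ) *
          ∑ k ∈ Finset.range (m + 1), t ^ k *
            localForm k Y N φ (fun x => dist (Y x) O ^ 2) x) := by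
  have h := hY.integral_mul_divergence t O hφ hc hs
  have e1 : ∫ x, φ x * ∑ i, partialAt (newtonField t O Y N i) x i
      = ∫ x in U, φ x * ∑ i, partialAt (newtonField t O Y N i) x i := by
    refine (setIntegral_eq_integral_of_forall_compl_eq_zero fun x hx => ?_).symm
    rw [image_eq_zero_of_notMem_tsupport fun h' => hx (hs h'), zero_mul]
  have e2 : ∫ x, ∑ i, partialAt φ x i * newtonField t O Y N i x
      = ∫ x in U, ∑ i, partialAt φ x i * newtonField t O Y N i x := by
    refine (setIntegral_eq_integral_of_forall_compl_eq_zero fun x hx => ?_).symm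
    refine Finset.sum_eq_zero fun i _ => ?_
    have h0 : partialAt φ x i = 0 := image_eq_zero_of_notMem_tsupport
      (f := fun x => partialAt φ x i) fun h' => hx (hs (tsupport_fderiv_apply_subset ℝ _ h'))
    rw [h0, zero_mul]
  rw [e1, e2, ← integral_neg] at h
  have hm := hY.isOpen.measurableSet
  refine Eq.trans (setIntegral_congr_fun hm fun x hx => ?_)
    (h.trans (setIntegral_congr_fun hm fun x hx => ?_))
  · simp only [hY.sum_partialAt_newtonField t O hx]
    ring
  · have h2 : ∀ k, t ^ k * localForm k Y N φ (fun x => dist (Y x) O ^ 2) x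
        = 2 * (t ^ k * newtonForm k (shapeCoeff Y N x) (partialAt φ x) (posCoeff O Y x)) := by
      intro k
      rw [hY.localForm_distSq k O φ hx]
      ring
    simp only [h2, ← Finset.mul_sum, sum_pow_mul_newtonForm, newtonField]
    rw [← mul_assoc (-(1 / 2 : ℝ))]
    norm_num
    rw [Finset.mul_sum]
    refine Finset.sum_congr rfl fun i _ => ?_
    ring

end IsLocalHypersurface

/-! ### Change of coordinates -/

section ChangeOfCoordinates

variable {m n : ℕ}

/-- The Jacobian matrix, `(i, a) ↦ ∂_i ψ^a`. -/
def jacobian (ψ : Euc m → Euc m) (x : Euc m) : Matrix (Fin m) (Fin m) ℝ :=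
  Matrix.of fun i a => partialAt ψ x i a

theorem det_jacobian (ψ : Euc m → Euc m) (x : Euc m) :
    (jacobian ψ x).det = (fderiv ℝ ψ x).det := by
  have h := LinearMap.det_toMatrix (EuclideanSpace.basisFun (Fin m) ℝ).toBasis
    (fderiv ℝ ψ x : Euc m →ₗ[ℝ] Euc m)
  rw [ContinuousLinearMap.det, ← h, ← Matrix.det_transpose]
  congr 1

theorem partialAt_comp {F : Type*} [NormedAddCommGroup F] [NormedSpace ℝ F] {f : Euc m → F}
    {ψ : Euc m → Euc m} {x : Euc m} (hf : DifferentiableAt ℝ f (ψ x))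
    (hψ : DifferentiableAt ℝ ψ x) (i : Fin m) :
    partialAt (f ∘ ψ) x i = ∑ a, jacobian ψ x i a • partialAt f (ψ x) a := by
  rw [partialAt, fderiv_comp x hf hψ, ContinuousLinearMap.comp_apply]
  have h : fderiv ℝ ψ x (EuclideanSpace.single i 1)
      = ∑ a, jacobian ψ x i a • EuclideanSpace.single a (1 : ℝ) := by
    ext b
    simp [jacobian, partialAt, Pi.single_apply]
  rw [h, map_sum]
  simp [partialAt]

theorem sum_inner_smul_smul (J : Matrix (Fin m) (Fin m) ℝ) (v w : Fin m → Euc n) :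
    (Matrix.of fun i j => inner ℝ (∑ a, J i a • v a) (∑ b, J j b • w b))
      = J * (Matrix.of fun a b => inner ℝ (v a) (w b)) * J.transpose := by
  ext i j
  simp only [Matrix.mul_apply, Matrix.of_apply, Matrix.transpose_apply, sum_inner, inner_sum,
    inner_smul_left, inner_smul_right, Finset.sum_mul, Finset.mul_sum]
  refine Finset.sum_congr rfl fun b _ => Finset.sum_congr rfl fun a _ => ?_
  simp
  ring

variable {Y N : Euc m → Euc n} {ψ : Euc m → Euc m} {x : Euc m}

theorem metricCoeff_comp (hY : DifferentiableAt ℝ Y (ψ x)) (hψ : DifferentiableAt ℝ ψ x) :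
    metricCoeff (Y ∘ ψ) x
      = jacobian ψ x * metricCoeff Y (ψ x) * (jacobian ψ x).transpose := by
  simp only [metricCoeff, partialAt_comp hY hψ, sum_inner_smul_smul]

theorem sffCoeff_comp (hY : DifferentiableAt ℝ Y (ψ x)) (hN : DifferentiableAt ℝ N (ψ x))
    (hψ : DifferentiableAt ℝ ψ x) :
    sffCoeff (Y ∘ ψ) (N ∘ ψ) x
      = jacobian ψ x * sffCoeff Y N (ψ x) * (jacobian ψ x).transpose := by
  simp only [sffCoeff, partialAt_comp hY hψ, partialAt_comp hN hψ, sum_inner_smul_smul]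

theorem sqrt_det_metricCoeff_comp (hY : DifferentiableAt ℝ Y (ψ x))
    (hψ : DifferentiableAt ℝ ψ x) :
    Real.sqrt (metricCoeff (Y ∘ ψ) x).det
      = |(fderiv ℝ ψ x).det| * Real.sqrt (metricCoeff Y (ψ x)).det := by
  rw [metricCoeff_comp hY hψ, Matrix.det_mul, Matrix.det_mul, Matrix.det_transpose,
    det_jacobian, mul_right_comm, ← sq, Real.sqrt_mul (sq_nonneg _), Real.sqrt_sq_eq_abs]

theorem shapeCoeff_comp (hY : DifferentiableAt ℝ Y (ψ x)) (hN : DifferentiableAt ℝ N (ψ x))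
    (hψ : DifferentiableAt ℝ ψ x) (hJ : IsUnit (jacobian ψ x).det) :
    shapeCoeff (Y ∘ ψ) (N ∘ ψ) x
      = jacobian ψ x * shapeCoeff Y N (ψ x) * (jacobian ψ x)⁻¹ := by
  have hJt : IsUnit (jacobian ψ x).transpose.det := by rwa [Matrix.det_transpose]
  rw [shapeCoeff_eq_mul_inv, shapeCoeff_eq_mul_inv, metricCoeff_comp hY hψ,
    sffCoeff_comp hY hN hψ, Matrix.mul_inv_rev, Matrix.mul_inv_rev]
  simp only [mul_assoc]
  rw [Matrix.mul_nonsing_inv_cancel_left _ _ hJt]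

theorem partialAt_comp_eq_mulVec {f : Euc m → ℝ} (hf : DifferentiableAt ℝ f (ψ x))
    (hψ : DifferentiableAt ℝ ψ x) :
    partialAt (f ∘ ψ) x = (jacobian ψ x).mulVec (partialAt f (ψ x)) := by
  ext i
  rw [partialAt_comp hf hψ]
  rfl

theorem localForm_comp {k : ℕ} (hk : k ≤ m) {f w : Euc m → ℝ}
    (hY : DifferentiableAt ℝ Y (ψ x)) (hN : DifferentiableAt ℝ N (ψ x))
    (hf : DifferentiableAt ℝ f (ψ x)) (hw : DifferentiableAt ℝ w (ψ x))
    (hψ : DifferentiableAt ℝ ψ x) (hJ : IsUnit (jacobian ψ x).det) :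
    localForm k (Y ∘ ψ) (N ∘ ψ) (f ∘ ψ) (w ∘ ψ) x = localForm k Y N f w (ψ x) := by
  rw [localForm, shapeCoeff_comp hY hN hψ hJ, partialAt_comp_eq_mulVec hf hψ,
    partialAt_comp_eq_mulVec hw hψ, metricCoeff_comp hY hψ, Matrix.mul_inv_rev,
    Matrix.mul_inv_rev, Matrix.mulVec_mulVec, mul_assoc (jacobian ψ x).transpose⁻¹,
    mul_assoc (metricCoeff Y (ψ x))⁻¹, Matrix.nonsing_inv_mul _ hJ, mul_one, ← Matrix.mulVec_mulVec, ← Matrix.transpose_nonsing_inv,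
    newtonForm_conj (Matrix.mul_nonsing_inv _ hJ) hk]
  rfl

theorem sigmaMatrix_shapeCoeff_comp (k : ℕ)
    (hY : DifferentiableAt ℝ Y (ψ x)) (hN : DifferentiableAt ℝ N (ψ x))
    (hψ : DifferentiableAt ℝ ψ x) (hJ : IsUnit (jacobian ψ x).det) :
    sigmaMatrix k (shapeCoeff (Y ∘ ψ) (N ∘ ψ) x) = sigmaMatrix k (shapeCoeff Y N (ψ x)) := by
  rw [shapeCoeff_comp hY hN hψ hJ, sigmaMatrix_conj (Matrix.mul_nonsing_inv _ hJ)]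

/-- From $g=Jg'J^T$: a nondegenerate metric in the first chart forces the Jacobian to be invertible.
-/
theorem isUnit_det_jacobian (hY : DifferentiableAt ℝ Y (ψ x)) (hψ : DifferentiableAt ℝ ψ x)
    (h : (metricCoeff (Y ∘ ψ) x).det ≠ 0) : IsUnit (jacobian ψ x).det := by
  rw [metricCoeff_comp hY hψ, Matrix.det_mul, Matrix.det_mul] at h
  exact (left_ne_zero_of_mul (left_ne_zero_of_mul h)).isUnit

theorem metricCoeff_congr {Y Y' : Euc m → Euc n} (h : Y =ᶠ[nhds x] Y') :
    metricCoeff Y x = metricCoeff Y' x := by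
  simp only [metricCoeff, partialAt_congr h]

theorem shapeCoeff_congr {Y Y' N N' : Euc m → Euc n} (h : Y =ᶠ[nhds x] Y')
    (h' : N =ᶠ[nhds x] N') : shapeCoeff Y N x = shapeCoeff Y' N' x := by
  simp only [shapeCoeff, sffCoeff, metricCoeff_congr h, partialAt_congr h, partialAt_congr h']

theorem localForm_congr (k : ℕ) {Y Y' N N' : Euc m → Euc n} {f f' w w' : Euc m → ℝ}
    (h : Y =ᶠ[nhds x] Y') (h' : N =ᶠ[nhds x] N') (hf : f =ᶠ[nhds x] f') (hw : w =ᶠ[nhds x] w') :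
    localForm k Y N f w x = localForm k Y' N' f' w' x := by
  have e1 : partialAt f x = partialAt f' x := funext (partialAt_congr hf)
  have e2 : partialAt w x = partialAt w' x := funext (partialAt_congr hw)
  rw [localForm, localForm, shapeCoeff_congr h h', metricCoeff_congr h, e1, e2]

end ChangeOfCoordinates

/-! ### Continuity of the local expressions -/

namespace IsLocalHypersurface

variable {m : ℕ} {U : Set (Euc m)} {Y N : Euc m → Euc (m + 1)} (hY : IsLocalHypersurface U Y N)
include hY

theorem continuousOn_metricCoeff : ContinuousOn (metricCoeff Y) U := by
  refine continuousOn_pi.2 fun i => continuousOn_pi.2 fun j => ?_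
  exact (contDiffOn_partialAt hY.smooth hY.isOpen i).continuousOn.inner
    (contDiffOn_partialAt hY.smooth hY.isOpen j).continuousOn

theorem continuousOn_det_metricCoeff : ContinuousOn (fun x => (metricCoeff Y x).det) U :=
  (Continuous.matrix_det continuous_id).comp_continuousOn hY.continuousOn_metricCoeff

theorem continuousOn_inv_metricCoeff : ContinuousOn (fun x => (metricCoeff Y x)⁻¹) U := by
  simp_rw [Matrix.inv_def, Ring.inverse_eq_inv']
  exact (hY.continuousOn_det_metricCoeff.inv₀ fun x hx => (hY.det_metricCoeff_pos hx).ne').smul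
    ((Continuous.matrix_adjugate continuous_id).comp_continuousOn hY.continuousOn_metricCoeff)

theorem continuousOn_shapeCoeff : ContinuousOn (shapeCoeff Y N) U := by
  have h : ContinuousOn (sffCoeff Y N) U := by
    refine continuousOn_pi.2 fun i => continuousOn_pi.2 fun j => ?_
    exact (contDiffOn_partialAt hY.smooth_normal hY.isOpen i).continuousOn.inner
      (contDiffOn_partialAt hY.smooth hY.isOpen j).continuousOn
  have h2 : shapeCoeff Y N = fun x => sffCoeff Y N x * (metricCoeff Y x)⁻¹ :=
    funext (shapeCoeff_eq_mul_inv Y N)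
  rw [h2]
  exact h.mul hY.continuousOn_inv_metricCoeff

theorem continuousOn_sigmaMatrix (k : ℕ) :
    ContinuousOn (fun x => sigmaMatrix k (shapeCoeff Y N x)) U :=
  (continuous_sigmaMatrix k).comp_continuousOn hY.continuousOn_shapeCoeff

theorem continuousOn_localForm (k : ℕ) {f w : Euc m → ℝ} (hf : ContDiffOn ℝ ∞ f U)
    (hw : ContDiffOn ℝ ∞ w U) : ContinuousOn (localForm k Y N f w) U := by
  have hc : ContinuousOn (fun x => (metricCoeff Y x)⁻¹.mulVec (partialAt w x)) U := by
    have h2 : ContinuousOn (partialAt w) U :=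
      continuousOn_pi.2 fun i => (contDiffOn_partialAt hw hY.isOpen i).continuousOn
    exact (Continuous.matrix_mulVec continuous_fst continuous_snd).comp_continuousOn
      (hY.continuousOn_inv_metricCoeff.prodMk h2)
  unfold localForm newtonForm
  refine continuousOn_finsetSum _ fun i _ => continuousOn_finsetSum _ fun j _ => ?_
  exact (((continuous_newton_apply k i j).comp_continuousOn hY.continuousOn_shapeCoeff).mul
    (contDiffOn_partialAt hf hY.isOpen i).continuousOn).mul (continuousOn_pi.1 hc j)

end IsLocalHypersurface

/-! ### Charts of an immersed hypersurface -/

section Charts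

variable {m n : ℕ} {M : Type*} [TopologicalSpace M] [ChartedSpace (Euc m) M]
  [IsManifold (𝓡 m) ∞ M]

theorem contDiffOn_comp_symm {F : Type*} [NormedAddCommGroup F] [NormedSpace ℝ F] {f : M → F}
    (hf : ContMDiff (𝓡 m) 𝓘(ℝ, F) ∞ f) {e : OpenPartialHomeomorph M (Euc m)}
    (he : e ∈ atlas (Euc m) M) : ContDiffOn ℝ ∞ (f ∘ e.symm) e.target := by
  rw [← contMDiffOn_iff_contDiffOn]
  exact hf.comp_contMDiffOn (contMDiffOn_symm_of_mem_maximalAtlas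
    (StructureGroupoid.subset_maximalAtlas _ he))

/-- The transition map between two charts. -/
def transition (e e' : OpenPartialHomeomorph M (Euc m)) : Euc m → Euc m := e' ∘ e.symm

theorem differentiableAt_transition {e e' : OpenPartialHomeomorph M (Euc m)}
    (he : e ∈ atlas (Euc m) M) (he' : e' ∈ atlas (Euc m) M) {x : Euc m} (hx : x ∈ e.target)
    (hx' : e.symm x ∈ e'.source) : DifferentiableAt ℝ (transition e e') x := by
  have : IsManifold (𝓡 m) 1 M := IsManifold.of_le (n := ∞) (by simp)
  exact ((mdifferentiableAt_atlas (I := 𝓡 m) he' hx').comp x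
    (mdifferentiableAt_atlas_symm (I := 𝓡 m) he hx)).differentiableAt

omit [ChartedSpace (Euc m) M] [IsManifold (𝓡 m) ∞ M] in
theorem comp_symm_eventuallyEq {F : Type*} (f : M → F) {e e' : OpenPartialHomeomorph M (Euc m)}
    {x : Euc m} (hx : x ∈ e.target) (hx' : e.symm x ∈ e'.source) :
    f ∘ e.symm =ᶠ[nhds x] (f ∘ e'.symm) ∘ transition e e' := by
  filter_upwards [(e.continuousAt_symm hx).preimage_mem_nhds (e'.open_source.mem_nhds hx')] with y hy
  simp [transition, e'.left_inv hy]

theorem differentiableAt_comp_symm {F : Type*} [NormedAddCommGroup F] [NormedSpace ℝ F]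
    {f : M → F} (hf : ContMDiff (𝓡 m) 𝓘(ℝ, F) ∞ f) {e : OpenPartialHomeomorph M (Euc m)}
    (he : e ∈ atlas (Euc m) M) {x : Euc m} (hx : x ∈ e.target) :
    DifferentiableAt ℝ (f ∘ e.symm) x :=
  (contDiffOn_comp_symm hf he).differentiableAt_of_isOpen e.open_target hx

theorem IsImmersedWithUnitNormal.isLocalHypersurface {X ν : M → Euc (m + 1)}
    (hX : IsImmersedWithUnitNormal (m := m) X ν) {e : OpenPartialHomeomorph M (Euc m)}
    (he : e ∈ atlas (Euc m) M) : IsLocalHypersurface e.target (X ∘ e.symm) (ν ∘ e.symm) := by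
  have : IsManifold (𝓡 m) 1 M := IsManifold.of_le (n := ∞) (by simp)
  have hpart : ∀ x ∈ e.target, ∀ i, partialAt (X ∘ e.symm) x i
      = mfderiv (𝓡 m) 𝓘(ℝ, Euc (m + 1)) X (e.symm x)
        (mfderiv (𝓡 m) (𝓡 m) e.symm x (EuclideanSpace.single i (1 : ℝ) : Euc m)) := by
    intro x hx i
    have h := mfderiv_comp x ((hX.smooth (e.symm x)).mdifferentiableAt (by simp))
      (mdifferentiableAt_atlas_symm (I := 𝓡 m) he hx)
    rw [mfderiv_eq_fderiv] at h
    exact congrArg (fun L => L (EuclideanSpace.single i (1 : ℝ) : Euc m)) h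
  refine ⟨e.open_target, contDiffOn_comp_symm hX.smooth he, contDiffOn_comp_symm hX.smooth_normal he,
    fun x _ => hX.norm_normal _, fun x hx i => ?_, fun x hx => ?_⟩
  · rw [hpart x hx]
    exact hX.normal _ _
  · have h0 : LinearIndependent ℝ fun i : Fin m => (EuclideanSpace.single i (1 : ℝ) : Euc m) := by
      have := (EuclideanSpace.basisFun (Fin m) ℝ).toBasis.linearIndependent
      rw [show (fun i : Fin m => (EuclideanSpace.single i (1 : ℝ) : Euc m))
        = (EuclideanSpace.basisFun (Fin m) ℝ).toBasis by ext1 i; simp]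
      exact this
    have hinj : Function.Injective (fderiv ℝ (X ∘ e.symm) x) := by
      have h := mfderiv_comp x ((hX.smooth (e.symm x)).mdifferentiableAt (by simp))
        (mdifferentiableAt_atlas_symm (I := 𝓡 m) he hx)
      rw [mfderiv_eq_fderiv] at h
      rw [h]
      exact (hX.immersion _).comp
        ((mdifferentiable_of_mem_atlas (I := 𝓡 m) he).symm.mfderiv_injective hx)
    exact h0.map' (fderiv ℝ (X ∘ e.symm) x : Euc m →ₗ[ℝ] Euc (m + 1))
      (LinearMap.ker_eq_bot.2 hinj)

/-! ### Global expressions and their independence of the chart -/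

/-- The `k`-th elementary symmetric function of the principal curvatures. -/
def sigmaAt (m : ℕ) {n : ℕ} {M : Type*} [TopologicalSpace M] [ChartedSpace (Euc m) M]
    (k : ℕ) (X ν : M → Euc n) (p : M) : ℝ :=
  sigmaMatrix k (shapeAt (m := m) X ν p)

/-- `(T_k)^{ij} ∇_i f ∇_j w` at `p`. -/
def gradForm (m : ℕ) {n : ℕ} {M : Type*} [TopologicalSpace M] [ChartedSpace (Euc m) M]
    (k : ℕ) (X ν : M → Euc n) (f w : M → ℝ) (p : M) : ℝ :=
  localForm k (localExpr (m := m) X p) (localExpr ν p) (localExpr f p) (localExpr w p) (coordsAt p)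

section Immersed

variable {X ν : M → Euc (m + 1)} (hX : IsImmersedWithUnitNormal (m := m) X ν)
include hX

theorem IsImmersedWithUnitNormal.isUnit_det_jacobian_transition
    {e e' : OpenPartialHomeomorph M (Euc m)}
    (he : e ∈ atlas (Euc m) M) (he' : e' ∈ atlas (Euc m) M) {x : Euc m} (hx : x ∈ e.target)
    (hx' : e.symm x ∈ e'.source) : IsUnit (jacobian (transition e e') x).det := by
  have hm : transition e e' x ∈ e'.target := e'.map_source hx'
  refine isUnit_det_jacobian (Y := X ∘ e'.symm) (differentiableAt_comp_symm hX.smooth he' hm)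
    (differentiableAt_transition he he' hx hx') ?_
  rw [← metricCoeff_congr (comp_symm_eventuallyEq X hx hx')]
  exact ((hX.isLocalHypersurface he).det_metricCoeff_pos hx).ne'

/-- `sigmaAt` uses the preferred chart of each point, which changes from point to point. Invariance
under conjugation lets one fixed chart serve on its whole domain, as continuity and integration
require. -/
theorem IsImmersedWithUnitNormal.sigmaAt_symm (k : ℕ) {e : OpenPartialHomeomorph M (Euc m)}
    (he : e ∈ atlas (Euc m) M) {x : Euc m} (hx : x ∈ e.target) :
    sigmaAt m k X ν (e.symm x) = sigmaMatrix k (shapeCoeff (X ∘ e.symm) (ν ∘ e.symm) x) := by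
  set e' := chartAt (Euc m) (e.symm x) with hdef
  have he' : e' ∈ atlas (Euc m) M := chart_mem_atlas _ _
  have hx' : e.symm x ∈ e'.source := mem_chart_source _ _
  have hm : transition e e' x ∈ e'.target := e'.map_source hx'
  rw [shapeCoeff_congr (comp_symm_eventuallyEq X hx hx') (comp_symm_eventuallyEq ν hx hx'),
    sigmaMatrix_shapeCoeff_comp k (differentiableAt_comp_symm hX.smooth he' hm)
      (differentiableAt_comp_symm hX.smooth_normal he' hm)
      (differentiableAt_transition he he' hx hx')
      (hX.isUnit_det_jacobian_transition he he' hx hx')]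
  rfl

theorem IsImmersedWithUnitNormal.gradForm_symm {k : ℕ} (hk : k ≤ m) {f w : M → ℝ}
    (hf : ContMDiff (𝓡 m) 𝓘(ℝ, ℝ) ∞ f) (hw : ContMDiff (𝓡 m) 𝓘(ℝ, ℝ) ∞ w)
    {e : OpenPartialHomeomorph M (Euc m)}
    (he : e ∈ atlas (Euc m) M) {x : Euc m} (hx : x ∈ e.target) :
    gradForm m k X ν f w (e.symm x)
      = localForm k (X ∘ e.symm) (ν ∘ e.symm) (f ∘ e.symm) (w ∘ e.symm) x := by
  set e' := chartAt (Euc m) (e.symm x) with hdef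
  have he' : e' ∈ atlas (Euc m) M := chart_mem_atlas _ _
  have hx' : e.symm x ∈ e'.source := mem_chart_source _ _
  have hm : transition e e' x ∈ e'.target := e'.map_source hx'
  rw [localForm_congr k (comp_symm_eventuallyEq X hx hx') (comp_symm_eventuallyEq ν hx hx')
      (comp_symm_eventuallyEq f hx hx') (comp_symm_eventuallyEq w hx hx'),
    localForm_comp hk (differentiableAt_comp_symm hX.smooth he' hm)
      (differentiableAt_comp_symm hX.smooth_normal he' hm)
      (differentiableAt_comp_symm hf he' hm) (differentiableAt_comp_symm hw he' hm)
      (differentiableAt_transition he he' hx hx')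
      (hX.isUnit_det_jacobian_transition he he' hx hx')]
  rfl

omit hX [IsManifold (𝓡 m) ∞ M] in
theorem continuous_of_continuousOn_comp_symm {f : M → ℝ}
    (h : ∀ e ∈ atlas (Euc m) M, ContinuousOn (f ∘ e.symm) e.target) : Continuous f := by
  refine continuous_iff_continuousAt.2 fun p => ?_
  set e := chartAt (Euc m) p
  have hp : p ∈ e.source := mem_chart_source _ _
  have h1 : ContinuousAt ((f ∘ e.symm) ∘ e) p :=
    ContinuousAt.comp ((h e (chart_mem_atlas _ _)).continuousAt
      (e.open_target.mem_nhds (e.map_source hp))) (e.continuousAt hp)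
  refine h1.congr ?_
  filter_upwards [e.open_source.mem_nhds hp] with q hq
  simp [e.left_inv hq]

theorem IsImmersedWithUnitNormal.continuous_sigmaAt (k : ℕ) : Continuous (sigmaAt m k X ν) :=
  continuous_of_continuousOn_comp_symm fun _ he =>
    ((hX.isLocalHypersurface he).continuousOn_sigmaMatrix k).congr
      fun _ hx => hX.sigmaAt_symm k he hx

theorem IsImmersedWithUnitNormal.continuous_gradForm {k : ℕ} (hk : k ≤ m) {f w : M → ℝ}
    (hf : ContMDiff (𝓡 m) 𝓘(ℝ, ℝ) ∞ f) (hw : ContMDiff (𝓡 m) 𝓘(ℝ, ℝ) ∞ w) :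
    Continuous (gradForm m k X ν f w) :=
  continuous_of_continuousOn_comp_symm fun _ he =>
    ((hX.isLocalHypersurface he).continuousOn_localForm k (contDiffOn_comp_symm hf he)
      (contDiffOn_comp_symm hw he)).congr fun _ hx => hX.gradForm_symm hk hf hw he hx

/-- Real roots of the characteristic polynomial account for all eigenvalues because it splits, `A`
being self-adjoint with respect to $g$. Afterwards only the polynomial in the entries is used. -/
theorem IsImmersedWithUnitNormal.H_eq {k : ℕ} (hk : k ≤ m) (p : M) :
    H m k X ν p = sigmaAt m k X ν p / (m.choose k : ℝ) := by
  have hs : (shapeAt (m := m) X ν p).charpoly.Splits :=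
    (hX.isLocalHypersurface (chart_mem_atlas (Euc m) p)).splits_charpoly_shapeCoeff
      (mem_chart_target (Euc m) p)
  rw [H, sigmaAt, sigmaMatrix_eq_esymm k hk _ hs]
  rfl

omit hX [IsManifold (𝓡 m) ∞ M] in
theorem newtonGrad_eq_gradForm (k : ℕ) (f : M → ℝ) (p : M) :
    newtonGrad m k X ν f p = gradForm m k X ν f f p :=
  sum_newtonUpper_mul k _ _ _ _ _

theorem IsImmersedWithUnitNormal.newtonShapeGrad_eq_gradForm (k : ℕ) (O : Euc (m + 1)) (p : M) :
    newtonShapeGrad m k X ν (rsq O X) p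
      = 2 * gradForm m k X ν (support O X ν) (rsq O X) p := by
  have hloc := hX.isLocalHypersurface (chart_mem_atlas (Euc m) p)
  have h := hloc.partialAt_support O (mem_chart_target (Euc m) p)
  set a := partialAt (localExpr (m := m) (rsq O X) p) (coordsAt p) with ha
  have h1 : newtonShapeGrad m k X ν (rsq O X) p
      = newtonForm k (shapeAt (m := m) X ν p) ((shapeAt (m := m) X ν p).mulVec a)
        ((metricCoeff (localExpr (m := m) X p) (coordsAt p))⁻¹.mulVec a) := by
    rw [newtonShapeGrad, shapeAt, ← sum_newtonUpper_mul]
    refine Finset.sum_congr rfl fun i _ => Finset.sum_congr rfl fun j _ => ?_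
    simp only [Matrix.mulVec, dotProduct, Finset.mul_sum, Finset.sum_mul]
    refine Finset.sum_congr rfl fun l _ => ?_
    ring
  have h2 : partialAt (localExpr (m := m) (support O X ν) p) (coordsAt p)
      = (1 / 2 : ℝ) • (shapeAt (m := m) X ν p).mulVec a := h
  rw [h1, gradForm, localForm, h2, newtonForm_smul_left, ← mul_assoc]
  norm_num
  rfl

end Immersed

end Charts

/-! ### The area measure in a chart -/

section Area

theorem _root_.ContinuousOn.measurableSet_inter_preimage {α β : Type*} [TopologicalSpace α]
    [MeasurableSpace α] [OpensMeasurableSpace α] [TopologicalSpace β] [MeasurableSpace β]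
    [BorelSpace β] {f : α → β} {U : Set α} (hf : ContinuousOn f U) (hU : MeasurableSet U)
    {s : Set β} (hs : MeasurableSet s) : MeasurableSet (U ∩ f ⁻¹' s) := by
  have h := (continuousOn_iff_continuous_domRestrict.1 hf).measurable hs
  have h2 := hU.subtype_image h
  rwa [show U.domRestrict f ⁻¹' s = Subtype.val ⁻¹' (f ⁻¹' s) from rfl,
    Subtype.image_preimage_coe] at h2

variable {m n : ℕ}

/-- The area density `√(det g)` as an extended nonnegative real. -/
def areaDensity (Y : Euc m → Euc n) (x : Euc m) : ENNReal :=
  ENNReal.ofReal (Real.sqrt (metricCoeff Y x).det)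

theorem measurable_areaDensity (Y : Euc m → Euc n) : Measurable (areaDensity Y) := by
  have h : ∀ i, Measurable fun x => partialAt Y x i := fun i =>
    measurable_fderiv_apply_const ℝ Y _
  have hd : Measurable fun x => (metricCoeff Y x).det := by
    simp only [Matrix.det_apply]
    refine Finset.measurable_fun_sum _ fun σ _ => Measurable.const_smul
      (Finset.measurable_fun_prod _ fun i _ => ?_) _
    exact (h (σ i)).inner (h i)
  exact hd.sqrt.ennreal_ofReal

variable {M : Type*} [TopologicalSpace M] [MeasurableSpace M] [BorelSpace M]

/-- The measure `√(det g) dx` of a chart. -/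
def chartMeasure (X : M → Euc n) (e : OpenPartialHomeomorph M (Euc m)) : Measure M :=
  Measure.map e.symm ((volume.restrict e.target).withDensity (areaDensity (X ∘ e.symm)))

theorem aemeasurable_symm (X : M → Euc n) (e : OpenPartialHomeomorph M (Euc m)) :
    AEMeasurable e.symm
      ((volume.restrict e.target).withDensity (areaDensity (X ∘ e.symm))) :=
  (e.continuousOn_symm.aemeasurable e.open_target.measurableSet).mono_ac
    (withDensity_absolutelyContinuous _ _)

theorem chartMeasure_apply (X : M → Euc n) (e : OpenPartialHomeomorph M (Euc m)) {s : Set M}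
    (hs : MeasurableSet s) :
    chartMeasure X e s = ∫⁻ x in e.target ∩ e.symm ⁻¹' s, areaDensity (X ∘ e.symm) x := by
  rw [chartMeasure, Measure.map_apply_of_aemeasurable (aemeasurable_symm X e) hs,
    withDensity_apply', Measure.restrict_restrict' e.open_target.measurableSet, Set.inter_comm]

theorem chartMeasure_compl_source (X : M → Euc n) (e : OpenPartialHomeomorph M (Euc m)) :
    chartMeasure X e e.sourceᶜ = 0 := by
  rw [chartMeasure_apply X e e.open_source.measurableSet.compl]
  have : e.target ∩ e.symm ⁻¹' e.sourceᶜ = ∅ := by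
    ext x
    simp only [Set.mem_inter_iff, Set.mem_preimage, Set.mem_compl_iff, Set.mem_empty_iff_false,
      iff_false, not_and, not_not]
    exact fun hx => e.map_target hx
  rw [this, Measure.restrict_empty, lintegral_zero_measure]

theorem restrict_chartMeasure (X : M → Euc n) (e : OpenPartialHomeomorph M (Euc m)) :
    (chartMeasure X e).restrict e.source = chartMeasure X e :=
  Measure.restrict_eq_self_of_ae_mem (mem_ae_iff.2 (chartMeasure_compl_source X e))

variable [ChartedSpace (Euc m) M] [IsManifold (𝓡 m) ∞ M]

/-- Change of variables along the transition map, whose factor $|\det D\psi|$ is absorbed by the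
transformation law of $\sqrt{\det g}$. -/
theorem chartMeasure_eq_of_subset {X : M → Euc n} (hX : ContMDiff (𝓡 m) 𝓘(ℝ, Euc n) ∞ X)
    {e e' : OpenPartialHomeomorph M (Euc m)} (he : e ∈ atlas (Euc m) M)
    (he' : e' ∈ atlas (Euc m) M) {s : Set M} (hs : MeasurableSet s)
    (hse : s ⊆ e.source) (hse' : s ⊆ e'.source) : chartMeasure X e s = chartMeasure X e' s := by
  rw [chartMeasure_apply X e hs, chartMeasure_apply X e' hs]
  set T := e.target ∩ e.symm ⁻¹' s with hT
  have hTm : MeasurableSet T :=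
    e.continuousOn_symm.measurableSet_inter_preimage e.open_target.measurableSet hs
  have himg : transition e e' '' T = e'.target ∩ e'.symm ⁻¹' s := by
    ext y
    constructor
    · rintro ⟨x, ⟨hx, hxs⟩, rfl⟩
      have hx' := hse' hxs
      refine ⟨e'.map_source hx', ?_⟩
      simp only [transition, Function.comp_apply, Set.mem_preimage, e'.left_inv hx']
      exact hxs
    · rintro ⟨hy, hys⟩
      have hy' := hse hys
      refine ⟨e (e'.symm y), ⟨e.map_source hy', ?_⟩, ?_⟩
      · simp only [Set.mem_preimage, e.left_inv hy']
        exact hys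
      · simp only [transition, Function.comp_apply, e.left_inv hy', e'.right_inv hy]
  have hinj : Set.InjOn (transition e e') T := by
    intro x hx y hy hxy
    have h1 : e.symm x = e.symm y := e'.injOn (hse' hx.2) (hse' hy.2) hxy
    exact e.symm.injOn hx.1 hy.1 h1
  rw [← himg, lintegral_image_eq_lintegral_abs_det_fderiv_mul volume hTm
    (fun x hx => (differentiableAt_transition he he' hx.1
      (hse' hx.2)).hasFDerivAt.hasFDerivWithinAt) hinj]
  refine setLIntegral_congr_fun hTm fun x hx => ?_
  have hm : transition e e' x ∈ e'.target := e'.map_source (hse' hx.2)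
  simp only [areaDensity]
  rw [← ENNReal.ofReal_mul (abs_nonneg _), ← sqrt_det_metricCoeff_comp
    (differentiableAt_comp_symm hX he' hm) (differentiableAt_transition he he' hx.1 (hse' hx.2)),
    metricCoeff_congr (comp_symm_eventuallyEq X hx.1 (hse' hx.2))]

theorem restrict_areaMeasure {X : M → Euc n} (hX : ContMDiff (𝓡 m) 𝓘(ℝ, Euc n) ∞ X)
    {e : OpenPartialHomeomorph M (Euc m)} (he : e ∈ atlas (Euc m) M) :
    (areaMeasure m X).restrict e.source = chartMeasure X e := by
  have hle : ∀ e' ∈ atlas (Euc m) M, chartMeasure X e' ≤ areaMeasure m X := fun e' he' =>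
    le_iSup₂ (f := fun e (_ : e ∈ atlas (Euc m) M) => chartMeasure X e) e' he'
  refine le_antisymm ?_ ?_
  -- To bound the supremum it suffices to bound each chart measure: inside the source of `e` it
  -- agrees with that of `e` on the overlap, and outside, the measure `⊤` dominates anything.
  -- Restriction to the source removes the second summand.
  · have hup : areaMeasure m X ≤ chartMeasure X e + (⊤ : Measure M).restrict e.sourceᶜ := by
      refine iSup₂_le fun e' he' => Measure.le_iff.2 fun s hs => ?_
      change chartMeasure X e' s ≤ _
      have hes := e.open_source.measurableSet
      have hes' := e'.open_source.measurableSet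
      rw [← measure_inter_add_sdiff s hes, Measure.add_apply]
      refine add_le_add ?_ ?_
      · have h1 : chartMeasure X e' (s ∩ e.source) = chartMeasure X e' (s ∩ e.source ∩ e'.source) := by
          rw [← measure_inter_add_sdiff (s ∩ e.source) hes']
          simp [measure_mono_null (Set.sdiff_subset_compl _ _) (chartMeasure_compl_source X e')]
        rw [h1, ← chartMeasure_eq_of_subset hX he he' ((hs.inter hes).inter hes')
          (Set.inter_subset_left.trans Set.inter_subset_right) Set.inter_subset_right]
        exact measure_mono (Set.inter_subset_left.trans Set.inter_subset_left)
      · rw [Measure.restrict_apply hs, ← Set.sdiff_eq]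
        exact (le_top : chartMeasure X e' ≤ ⊤) _
    calc (areaMeasure m X).restrict e.source
        ≤ (chartMeasure X e + (⊤ : Measure M).restrict e.sourceᶜ).restrict e.source :=
          Measure.restrict_mono le_rfl hup
      _ = chartMeasure X e := by
          rw [Measure.restrict_add, restrict_chartMeasure,
            Measure.restrict_restrict e.open_source.measurableSet]
          simp
  · rw [← restrict_chartMeasure]
    exact Measure.restrict_mono le_rfl (hle e he)

theorem setIntegral_areaMeasure {X : M → Euc n} (hX : ContMDiff (𝓡 m) 𝓘(ℝ, Euc n) ∞ X)
    {e : OpenPartialHomeomorph M (Euc m)} (he : e ∈ atlas (Euc m) M) {F : M → ℝ}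
    (hF : Continuous F) :
    ∫ p in e.source, F p ∂areaMeasure m X
      = ∫ x in e.target, Real.sqrt (metricCoeff (X ∘ e.symm) x).det * F (e.symm x) := by
  rw [restrict_areaMeasure hX he, chartMeasure, integral_map (aemeasurable_symm X e)
    hF.aestronglyMeasurable, integral_withDensity_eq_integral_toReal_smul
      (measurable_areaDensity _) (by simp [areaDensity])]
  simp [areaDensity, ENNReal.toReal_ofReal (Real.sqrt_nonneg _)]

theorem isLocallyFiniteMeasure_areaMeasure {X : M → Euc n}
    (hX : ContMDiff (𝓡 m) 𝓘(ℝ, Euc n) ∞ X) : IsLocallyFiniteMeasure (areaMeasure m X) := by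
  refine ⟨fun p => ?_⟩
  set e := chartAt (Euc m) p
  have he : e ∈ atlas (Euc m) M := chart_mem_atlas _ _
  have hp : p ∈ e.source := mem_chart_source _ _
  have hsm := contDiffOn_comp_symm hX he
  obtain ⟨K, hK, hKt, hKc⟩ := local_compact_nhds (e.open_target.mem_nhds (e.map_source hp))
  have hc : ContinuousOn (fun x => Real.sqrt (metricCoeff (X ∘ e.symm) x).det) K := by
    have hg : ContinuousOn (metricCoeff (X ∘ e.symm)) e.target :=
      continuousOn_pi.2 fun i => continuousOn_pi.2 fun j =>
        (contDiffOn_partialAt hsm e.open_target i).continuousOn.inner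
          (contDiffOn_partialAt hsm e.open_target j).continuousOn
    exact (((Continuous.matrix_det continuous_id).comp_continuousOn hg).sqrt).mono hKt
  refine ⟨e.source ∩ e ⁻¹' interior K, (e.continuousOn.isOpen_inter_preimage e.open_source
    isOpen_interior).mem_nhds ⟨hp, mem_interior_iff_mem_nhds.2 hK⟩, ?_⟩
  have hm : MeasurableSet (e.source ∩ e ⁻¹' interior K) :=
    (e.continuousOn.isOpen_inter_preimage e.open_source isOpen_interior).measurableSet
  have h1 : areaMeasure m X (e.source ∩ e ⁻¹' interior K)
      = chartMeasure X e (e.source ∩ e ⁻¹' interior K) := by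
    rw [← restrict_areaMeasure hX he, Measure.restrict_apply hm, Set.inter_eq_left.2
      Set.inter_subset_left]
  rw [h1, chartMeasure_apply X e hm]
  have hsub : e.target ∩ e.symm ⁻¹' (e.source ∩ e ⁻¹' interior K) ⊆ K := by
    rintro x ⟨hx, -, hx'⟩
    rw [Set.mem_preimage, e.right_inv hx] at hx'
    exact interior_subset hx'
  refine (lintegral_mono_set hsub).trans_lt ?_
  exact (hc.integrableOn_compact hKc).lintegral_lt_top

end Area

/-! ### The global integral formula -/

/-! ### Functions supported in one chart, carried to coordinate space. -/

section Transport

variable {m : ℕ} {M : Type*} [TopologicalSpace M] [ChartedSpace (Euc m) M]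

/-- A function on `M` read in a chart and extended by zero. -/
def chartExtend (e : OpenPartialHomeomorph M (Euc m)) (φ : M → ℝ) : Euc m → ℝ :=
  e.target.indicator (φ ∘ e.symm)

omit [ChartedSpace (Euc m) M] in
theorem chartExtend_eventuallyEq (e : OpenPartialHomeomorph M (Euc m)) (φ : M → ℝ) {x : Euc m}
    (hx : x ∈ e.target) : chartExtend e φ =ᶠ[nhds x] φ ∘ e.symm := by
  filter_upwards [e.open_target.mem_nhds hx] with y hy
  exact Set.indicator_of_mem hy _

omit [ChartedSpace (Euc m) M] in
theorem chartExtend_support_subset (e : OpenPartialHomeomorph M (Euc m)) (φ : M → ℝ) :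
    Function.support (chartExtend e φ) ⊆ e '' (tsupport φ ∩ e.source) := by
  intro x hx
  have hxt : x ∈ e.target := by
    by_contra h
    exact hx (Set.indicator_of_notMem h _)
  have h1 : φ (e.symm x) ≠ 0 := by
    rw [Function.mem_support, chartExtend, Set.indicator_of_mem hxt] at hx
    exact hx
  exact ⟨e.symm x, ⟨subset_tsupport _ h1, e.map_target hxt⟩, e.right_inv hxt⟩

variable [CompactSpace M]

omit [ChartedSpace (Euc m) M] in
theorem isCompact_image_tsupport {e : OpenPartialHomeomorph M (Euc m)} {φ : M → ℝ}
    (h : tsupport φ ⊆ e.source) : IsCompact (e '' (tsupport φ ∩ e.source)) := by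
  rw [Set.inter_eq_left.2 h]
  exact (isClosed_tsupport φ).isCompact.image_of_continuousOn (e.continuousOn.mono h)

-- The support of `φ` has compact, hence closed, image in coordinates, so taking the closure there
-- cannot reach the boundary of the target. This makes extension by zero smooth.
omit [ChartedSpace (Euc m) M] in
theorem tsupport_chartExtend_subset {e : OpenPartialHomeomorph M (Euc m)} {φ : M → ℝ}
    (h : tsupport φ ⊆ e.source) : tsupport (chartExtend e φ) ⊆ e.target := by
  refine (closure_minimal (chartExtend_support_subset e φ)
    (isCompact_image_tsupport h).isClosed).trans ?_
  rintro _ ⟨p, ⟨-, hp⟩, rfl⟩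
  exact e.map_source hp

omit [ChartedSpace (Euc m) M] in
theorem hasCompactSupport_chartExtend {e : OpenPartialHomeomorph M (Euc m)} {φ : M → ℝ}
    (h : tsupport φ ⊆ e.source) : HasCompactSupport (chartExtend e φ) :=
  HasCompactSupport.of_support_subset_isCompact (isCompact_image_tsupport h)
    (chartExtend_support_subset e φ)

theorem contDiff_chartExtend [IsManifold (𝓡 m) ∞ M] {e : OpenPartialHomeomorph M (Euc m)}
    (he : e ∈ atlas (Euc m) M) {φ : M → ℝ} (hφ : ContMDiff (𝓡 m) 𝓘(ℝ, ℝ) ∞ φ)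
    (h : tsupport φ ⊆ e.source) : ContDiff ℝ ∞ (chartExtend e φ) := by
  refine contDiff_iff_contDiffAt.2 fun x => ?_
  by_cases hx : x ∈ tsupport (chartExtend e φ)
  swap
  · exact (contDiffAt_const (c := (0 : ℝ))).congr_of_eventuallyEq
      (notMem_tsupport_iff_eventuallyEq.1 hx)
  have hx' := tsupport_chartExtend_subset h hx
  exact ((contDiffOn_comp_symm hφ he).contDiffAt (e.open_target.mem_nhds hx')).congr_of_eventuallyEq
    (chartExtend_eventuallyEq e φ hx')

end Transport

/-! ### The weighted Minkowski identity on the whole hypersurface. -/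

section Global

variable {m : ℕ} {M : Type*} [TopologicalSpace M] [ChartedSpace (Euc m) M]
  {X ν : M → Euc (m + 1)}

theorem gradForm_eq_zero_of_notMem_tsupport (k : ℕ) {f : M → ℝ} (w : M → ℝ) {p : M}
    (hp : p ∉ tsupport f) : gradForm m k X ν f w p = 0 := by
  have h0 : f =ᶠ[nhds p] 0 := notMem_tsupport_iff_eventuallyEq.1 hp
  set e := chartAt (Euc m) p with he
  have h1 : localExpr (m := m) f p =ᶠ[nhds (coordsAt p)] fun _ => 0 := by
    have hc := e.continuousAt_symm (mem_chart_target (Euc m) p)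
    have h2 : e.symm (e p) = p := e.left_inv (mem_chart_source (Euc m) p)
    rw [ContinuousAt, h2] at hc
    exact hc.eventually h0
  have h3 : partialAt (localExpr (m := m) f p) (coordsAt p) = 0 := by
    ext i
    rw [partialAt_congr h1]
    simp [partialAt]
  rw [gradForm, localForm, h3, ← zero_smul ℝ (0 : Fin m → ℝ), newtonForm_smul_left, zero_mul]

variable [IsManifold (𝓡 m) ∞ M]

theorem gradForm_sum {ι : Type*} [Fintype ι] (k : ℕ) {f : ι → M → ℝ}
    (hf : ∀ a, ContMDiff (𝓡 m) 𝓘(ℝ, ℝ) ∞ (f a)) (w : M → ℝ) (p : M) :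
    gradForm m k X ν (fun q => ∑ a, f a q) w p = ∑ a, gradForm m k X ν (f a) w p := by
  have hd : ∀ a, DifferentiableAt ℝ (localExpr (m := m) (f a) p) (coordsAt p) := fun a =>
    differentiableAt_comp_symm (hf a) (chart_mem_atlas _ p) (mem_chart_target _ p)
  have h1 : ∀ i, partialAt (localExpr (m := m) (fun q => ∑ a, f a q) p) (coordsAt p) i
      = ∑ a, partialAt (localExpr (m := m) (f a) p) (coordsAt p) i := by
    intro i
    have h := (HasFDerivAt.fun_sum (u := Finset.univ) fun a _ => (hd a).hasFDerivAt).fderiv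
    have h2 := congrArg (fun L => L (EuclideanSpace.single i (1 : ℝ))) h
    rw [sum_apply] at h2
    exact h2
  simp only [gradForm, localForm, newtonForm, h1, Finset.mul_sum, Finset.sum_mul]
  conv_rhs => rw [Finset.sum_comm]
  refine Finset.sum_congr rfl fun i _ => ?_
  conv_rhs => rw [Finset.sum_comm]

variable [CompactSpace M] [MeasurableSpace M] [BorelSpace M]
  (hX : IsImmersedWithUnitNormal (m := m) X ν)
include hX

theorem IsImmersedWithUnitNormal.integrable_of_continuous {F : M → ℝ} (hF : Continuous F) :
    Integrable F (areaMeasure m X) := by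
  have := isLocallyFiniteMeasure_areaMeasure (m := m) hX.smooth
  exact hF.integrable_of_hasCompactSupport (HasCompactSupport.of_compactSpace F)

omit [IsManifold (𝓡 m) ∞ M] [CompactSpace M] [MeasurableSpace M] [BorelSpace M] in
theorem IsImmersedWithUnitNormal.contMDiff_rsq (O : Euc (m + 1)) :
    ContMDiff (𝓡 m) 𝓘(ℝ, ℝ) ∞ (rsq O X) := by
  have h : ContDiff ℝ ∞ fun v : Euc (m + 1) => dist v O ^ 2 := by
    simp only [dist_eq_norm]
    exact (contDiff_id.sub contDiff_const).norm_sq ℝ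
  exact h.comp_contMDiff hX.smooth

omit [IsManifold (𝓡 m) ∞ M] [CompactSpace M] [MeasurableSpace M] [BorelSpace M] in
theorem IsImmersedWithUnitNormal.contMDiff_support (O : Euc (m + 1)) :
    ContMDiff (𝓡 m) 𝓘(ℝ, ℝ) ∞ (support O X ν) := by
  have h : ContDiff ℝ ∞ fun v : Euc (m + 1) × Euc (m + 1) => (inner ℝ (v.1 - O) v.2 : ℝ) :=
    (contDiff_fst.sub contDiff_const).inner ℝ contDiff_snd
  exact h.comp_contMDiff (hX.smooth.prodMk_space hX.smooth_normal)

/-- The integrand `T_k^{ij} ∇_i ∇_j (r² / 2)`, expressed through the mean curvatures. -/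
def newtonLaplace (k : ℕ) (O : Euc (m + 1)) (X ν : M → Euc (m + 1)) (p : M) : ℝ :=
  ((m : ℝ) - k) * sigmaAt m k X ν p
    - support O X ν p * ((k + 1 : ℝ) * sigmaAt m (k + 1) X ν p)

omit [CompactSpace M] [MeasurableSpace M] [BorelSpace M] in
theorem IsImmersedWithUnitNormal.continuous_newtonLaplace (k : ℕ) (O : Euc (m + 1)) :
    Continuous (newtonLaplace k O X ν) :=
  ((hX.continuous_sigmaAt k).const_mul _).sub ((hX.contMDiff_support O).continuous.mul
    ((hX.continuous_sigmaAt (k + 1)).const_mul _))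

theorem IsImmersedWithUnitNormal.integral_newtonLaplace_of_tsupport_subset (t : ℝ)
    (O : Euc (m + 1)) {e : OpenPartialHomeomorph M (Euc m)} (he : e ∈ atlas (Euc m) M) {φ : M → ℝ}
    (hφ : ContMDiff (𝓡 m) 𝓘(ℝ, ℝ) ∞ φ) (hs : tsupport φ ⊆ e.source) :
    ∫ p, φ p * ∑ k ∈ Finset.range (m + 1), t ^ k * newtonLaplace k O X ν p ∂areaMeasure m X
      = ∫ p, -(1 / 2 : ℝ) * ∑ k ∈ Finset.range (m + 1),
          t ^ k * gradForm m k X ν φ (rsq O X) p ∂areaMeasure m X := by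
  have hk : ∀ {k}, k ∈ Finset.range (m + 1) → k ≤ m := fun h =>
    Nat.le_of_lt_succ (Finset.mem_range.1 h)
  have hc1 : Continuous fun p =>
      φ p * ∑ k ∈ Finset.range (m + 1), t ^ k * newtonLaplace k O X ν p :=
    hφ.continuous.mul (continuous_finsetSum _ fun k _ =>
      (hX.continuous_newtonLaplace k O).const_mul _)
  have hc2 : Continuous fun p => -(1 / 2 : ℝ) * ∑ k ∈ Finset.range (m + 1),
      t ^ k * gradForm m k X ν φ (rsq O X) p :=
    (continuous_finsetSum _ fun k h =>
      (hX.continuous_gradForm (hk h) hφ (hX.contMDiff_rsq O)).const_mul _).const_mul _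
  have hloc := hX.isLocalHypersurface he
  have key := hloc.integral_localForm_distSq t O
    ((contDiff_chartExtend he hφ hs).of_le (by simp)) (hasCompactSupport_chartExtend hs)
    (tsupport_chartExtend_subset hs)
  -- Both integrands vanish off the chart domain, one through `φ` and the other through its
  -- gradient.
  rw [← setIntegral_eq_integral_of_forall_compl_eq_zero (s := e.source),
    ← setIntegral_eq_integral_of_forall_compl_eq_zero (s := e.source)
      (f := fun p => -(1 / 2 : ℝ) * _),
    setIntegral_areaMeasure hX.smooth he hc1, setIntegral_areaMeasure hX.smooth he hc2]
  · have hm := e.open_target.measurableSet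
    refine Eq.trans (setIntegral_congr_fun hm fun x hx => ?_)
      (key.trans (setIntegral_congr_fun hm fun x hx => ?_))
    · simp only [newtonLaplace, hX.sigmaAt_symm _ he hx,
        (chartExtend_eventuallyEq e φ hx).self_of_nhds]
      rfl
    · have hsum : ∑ k ∈ Finset.range (m + 1), t ^ k * localForm k (X ∘ e.symm) (ν ∘ e.symm)
            (chartExtend e φ) (fun x => dist ((X ∘ e.symm) x) O ^ 2) x
          = ∑ k ∈ Finset.range (m + 1), t ^ k * gradForm m k X ν φ (rsq O X) (e.symm x) := by
        refine Finset.sum_congr rfl fun k h => ?_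
        rw [hX.gradForm_symm (hk h) hφ (hX.contMDiff_rsq O) he hx,
          localForm_congr k .rfl .rfl (chartExtend_eventuallyEq e φ hx) .rfl]
        rfl
      exact congrArg (fun S => Real.sqrt (metricCoeff (X ∘ e.symm) x).det * (-(1 / 2 : ℝ) * S)) hsum
  · intro p hp
    simp only [gradForm_eq_zero_of_notMem_tsupport _ _ fun h => hp (hs h)]
    simp
  · intro p hp
    rw [image_eq_zero_of_notMem_tsupport fun h => hp (hs h), zero_mul]

variable [T2Space M]

/-- Both sides are linear in `f`, so a partition of unity subordinate to finitely many charts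
reduces to weights supported in one chart. -/
theorem IsImmersedWithUnitNormal.integral_sum_newtonLaplace (t : ℝ) (O : Euc (m + 1)) {f : M → ℝ}
    (hf : ContMDiff (𝓡 m) 𝓘(ℝ, ℝ) ∞ f) :
    ∫ p, f p * ∑ k ∈ Finset.range (m + 1), t ^ k * newtonLaplace k O X ν p ∂areaMeasure m X
      = ∫ p, -(1 / 2 : ℝ) * ∑ k ∈ Finset.range (m + 1),
          t ^ k * gradForm m k X ν f (rsq O X) p ∂areaMeasure m X := by
  have hk : ∀ {k}, k ∈ Finset.range (m + 1) → k ≤ m := fun h =>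
    Nat.le_of_lt_succ (Finset.mem_range.1 h)
  obtain ⟨s, hs⟩ := CompactSpace.elim_nhds_subcover (fun p : M => (chartAt (Euc m) p).source)
    fun p => chart_source_mem_nhds (Euc m) p
  obtain ⟨ρ, hρ⟩ := SmoothPartitionOfUnity.exists_isSubordinate (𝓡 m) (s := Set.univ)
    isClosed_univ (fun a : s => (chartAt (Euc m) (a : M)).source)
    (fun a => (chartAt (Euc m) (a : M)).open_source) (by
      intro p _
      have hp : p ∈ ⋃ q ∈ s, (chartAt (Euc m) q).source := by rw [hs]; trivial
      simp only [Set.mem_iUnion] at hp ⊢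
      obtain ⟨q, hq, hpq⟩ := hp
      exact ⟨⟨q, hq⟩, hpq⟩)
  set φ : s → M → ℝ := fun a p => ρ a p * f p with hφdef
  have hφ : ∀ a, ContMDiff (𝓡 m) 𝓘(ℝ, ℝ) ∞ (φ a) := fun a => (ρ a).contMDiff.mul hf
  have hφs : ∀ a, tsupport (φ a) ⊆ (chartAt (Euc m) (a : M)).source := fun a =>
    tsupport_mul_subset_left.trans (hρ a)
  have hsum : f = fun p => ∑ a, φ a p := by
    ext p
    have h1 := ρ.sum_eq_one (Set.mem_univ p)
    rw [finsum_eq_sum_of_fintype] at h1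
    simp only [hφdef, ← Finset.sum_mul, h1, one_mul]
  have hg : ∀ k p, gradForm m k X ν f (rsq O X) p
      = ∑ a, gradForm m k X ν (φ a) (rsq O X) p := by
    intro k p
    conv_lhs => rw [hsum]
    exact gradForm_sum k hφ _ p
  have e1 : ∀ p, f p * ∑ k ∈ Finset.range (m + 1), t ^ k * newtonLaplace k O X ν p
      = ∑ a, φ a p * ∑ k ∈ Finset.range (m + 1), t ^ k * newtonLaplace k O X ν p := by
    intro p
    rw [← Finset.sum_mul, ← congrFun hsum p]
  have e2 : ∀ p, -(1 / 2 : ℝ) * ∑ k ∈ Finset.range (m + 1), t ^ k * gradForm m k X ν f (rsq O X) p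
      = ∑ a, -(1 / 2 : ℝ) * ∑ k ∈ Finset.range (m + 1),
          t ^ k * gradForm m k X ν (φ a) (rsq O X) p := by
    intro p
    simp only [hg, Finset.mul_sum]
    rw [Finset.sum_comm]
  simp_rw [e1, e2]
  rw [integral_finsetSum, integral_finsetSum]
  · exact Finset.sum_congr rfl fun a _ => hX.integral_newtonLaplace_of_tsupport_subset t O
      (chart_mem_atlas _ _) (hφ a) (hφs a)
  · exact fun a _ => hX.integrable_of_continuous ((continuous_finsetSum _ fun k h =>
      (hX.continuous_gradForm (hk h) (hφ a) (hX.contMDiff_rsq O)).const_mul _).const_mul _)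
  · exact fun a _ => hX.integrable_of_continuous ((hφ a).continuous.mul
      (continuous_finsetSum _ fun k _ => (hX.continuous_newtonLaplace k O).const_mul _))

/-- The weighted Minkowski formula: `∫ f T_k^{ij} ∇_i ∇_j (r² / 2) = - ∫ T_k(∇f, ∇(r² / 2))`. -/
theorem IsImmersedWithUnitNormal.integral_newtonLaplace {k : ℕ} (hk : k ≤ m) (O : Euc (m + 1))
    {f : M → ℝ} (hf : ContMDiff (𝓡 m) 𝓘(ℝ, ℝ) ∞ f) :
    ∫ p, f p * newtonLaplace k O X ν p ∂areaMeasure m X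
      = -(1 / 2 : ℝ) * ∫ p, gradForm m k X ν f (rsq O X) p ∂areaMeasure m X := by
  -- The summed identity holds for all real $t$ and is polynomial in $t$, which isolates each `k`.
  refine coeff_eq_of_forall_sum_pow_mul_eq (N := m + 1)
    (a := fun k => ∫ p, f p * newtonLaplace k O X ν p ∂areaMeasure m X)
    (b := fun k => -(1 / 2 : ℝ) * ∫ p, gradForm m k X ν f (rsq O X) p ∂areaMeasure m X)
    (fun t => ?_) (Nat.lt_succ_of_le hk)
  have h := hX.integral_sum_newtonLaplace t O hf
  simp_rw [Finset.mul_sum] at h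
  rw [integral_finsetSum, integral_finsetSum] at h
  · refine Eq.trans (Finset.sum_congr rfl fun k _ => ?_)
      (h.trans (Finset.sum_congr rfl fun k _ => ?_))
    · rw [← integral_const_mul]
      refine integral_congr_ae (.of_forall fun p => ?_)
      simp only
      ring
    · rw [← integral_const_mul, ← integral_const_mul]
      refine integral_congr_ae (.of_forall fun p => ?_)
      simp only
      ring
  · exact fun k h => hX.integrable_of_continuous (((hX.continuous_gradForm
      (Nat.le_of_lt_succ (Finset.mem_range.1 h)) hf (hX.contMDiff_rsq O)).const_mul _).const_mul _)
  · exact fun k _ => hX.integrable_of_continuous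
      (hf.continuous.mul ((hX.continuous_newtonLaplace k O).const_mul _))

theorem IsImmersedWithUnitNormal.integral_mul_support_mul_H {k : ℕ} (hk : 1 ≤ k) (hkm : k ≤ m)
    (O : Euc (m + 1)) {f : M → ℝ} (hf : ContMDiff (𝓡 m) 𝓘(ℝ, ℝ) ∞ f) :
    Integrable (fun p => f p * support O X ν p * H m k X ν p) (areaMeasure m X) ∧
      Integrable (fun p => f p * H m (k - 1) X ν p) (areaMeasure m X) ∧
      Integrable (gradForm m (k - 1) X ν f (rsq O X)) (areaMeasure m X) ∧
      ∫ p, f p * support O X ν p * H m k X ν p ∂areaMeasure m X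
        = ∫ p, f p * H m (k - 1) X ν p ∂areaMeasure m X
          + 1 / (2 * (k : ℝ) * (m.choose k : ℝ))
            * ∫ p, gradForm m (k - 1) X ν f (rsq O X) p ∂areaMeasure m X := by
  obtain ⟨j, rfl⟩ := Nat.exists_eq_add_of_le' hk
  rw [Nat.add_sub_cancel]
  have hj : j ≤ m := by omega
  have i1 : Integrable (fun p => f p * support O X ν p * H m (j + 1) X ν p) (areaMeasure m X) := by
    simp only [hX.H_eq hkm]
    exact hX.integrable_of_continuous ((hf.continuous.mul (hX.contMDiff_support O).continuous).mul
      ((hX.continuous_sigmaAt _).div_const _))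
  have i2 : Integrable (fun p => f p * H m j X ν p) (areaMeasure m X) := by
    simp only [hX.H_eq hj]
    exact hX.integrable_of_continuous (hf.continuous.mul ((hX.continuous_sigmaAt _).div_const _))
  refine ⟨i1, i2, hX.integrable_of_continuous (hX.continuous_gradForm hj hf (hX.contMDiff_rsq O)),
    ?_⟩
  have hC : (0 : ℝ) < m.choose (j + 1) := by exact_mod_cast Nat.choose_pos hkm
  have hC' : (0 : ℝ) < m.choose j := by exact_mod_cast Nat.choose_pos hj
  -- This identity gives $H_j$ and $uH_{j+1}$ the same coefficient in `newtonLaplace`.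
  have hCC : (m.choose (j + 1) : ℝ) * (j + 1) = m.choose j * ((m : ℝ) - j) := by
    have := Nat.choose_succ_right_eq m j
    rw [← Nat.cast_sub hj]
    exact_mod_cast this
  have key := hX.integral_newtonLaplace hj O hf
  have hpt : ∀ p, f p * newtonLaplace j O X ν p
      = ((j + 1 : ℝ) * m.choose (j + 1)) *
        (f p * H m j X ν p - f p * support O X ν p * H m (j + 1) X ν p) := by
    intro p
    rw [hX.H_eq hkm, hX.H_eq hj, newtonLaplace]
    have h1 : ((j + 1 : ℝ) * m.choose (j + 1)) * (sigmaAt m j X ν p / m.choose j)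
        = ((m : ℝ) - j) * sigmaAt m j X ν p := by
      rw [mul_comm (j + 1 : ℝ), hCC]
      field_simp
    have h2 : ((j + 1 : ℝ) * m.choose (j + 1)) * (sigmaAt m (j + 1) X ν p / m.choose (j + 1))
        = (j + 1 : ℝ) * sigmaAt m (j + 1) X ν p := by
      field_simp
    linear_combination -(f p) * h1 + (f p * support O X ν p) * h2
  simp_rw [hpt] at key
  rw [integral_const_mul, integral_sub i2 i1] at key
  push_cast
  have hj1 : (0 : ℝ) < j + 1 := by positivity
  field_simp
  linarith

end Global

/-- Keeping `n = m + 1` as a hypothesis allows `subst` to remove the truncated subtraction `n - 1`.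
-/
theorem integral_formulas {m n k : ℕ} (hn : n = m + 1) (hk : 1 ≤ k) (hkm : k ≤ m)
    {M : Type*} [TopologicalSpace M] [T2Space M] [CompactSpace M]
    [ChartedSpace (Euc m) M] [IsManifold (𝓡 m) ∞ M] [MeasurableSpace M] [BorelSpace M]
    (X ν : M → Euc n) (hX : IsImmersedWithUnitNormal (m := m) X ν) (O : Euc n) :
    let μ := areaMeasure m X
    let r2 : M → ℝ := rsq O X
    let u : M → ℝ := support O X ν
    let H : ℕ → M → ℝ := fun j => Hypersurface.H m j X ν
    let TGrad : M → ℝ := newtonGrad m (k - 1) X ν r2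
    let ThGrad : M → ℝ := newtonShapeGrad m (k - 1) X ν r2
    (Integrable (fun p => r2 p * u p * H k p) μ ∧
      Integrable (fun p => r2 p * H (k - 1) p) μ ∧
      Integrable TGrad μ ∧
      ∫ p, r2 p * u p * H k p ∂μ
        = (∫ p, r2 p * H (k - 1) p ∂μ)
          + 1 / (2 * (k : ℝ) * (m.choose k : ℝ)) * ∫ p, TGrad p ∂μ) ∧
    (Integrable (fun p => u p ^ 2 * H k p) μ ∧
      Integrable (fun p => u p * H (k - 1) p) μ ∧
      Integrable ThGrad μ ∧
      ∫ p, u p ^ 2 * H k p ∂μ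
        = (∫ p, u p * H (k - 1) p ∂μ)
          + 1 / (4 * (k : ℝ) * (m.choose k : ℝ)) * ∫ p, ThGrad p ∂μ) := by
  intro μ r2 u H TGrad ThGrad
  subst hn
  have hT : TGrad = gradForm m (k - 1) X ν r2 r2 :=
    funext fun p => newtonGrad_eq_gradForm (k - 1) r2 p
  have hTh : ThGrad = fun p => 2 * gradForm m (k - 1) X ν u r2 p :=
    funext fun p => hX.newtonShapeGrad_eq_gradForm (k - 1) O p
  obtain ⟨a1, a2, a3, a4⟩ := hX.integral_mul_support_mul_H hk hkm O (hX.contMDiff_rsq O)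
  obtain ⟨b1, b2, b3, b4⟩ := hX.integral_mul_support_mul_H hk hkm O (hX.contMDiff_support O)
  rw [hT, hTh]
  refine ⟨⟨a1, a2, a3, a4⟩, ?_⟩
  simp_rw [sq]
  -- `ThGrad` is twice the form in $\nabla u$ and $\nabla r^2$, which changes $1/(2kC_m^k)$ into
  -- $1/(4kC_m^k)$.
  refine ⟨b1, b2, b3.const_mul 2, b4.trans ?_⟩
  congr 1
  rw [integral_const_mul, ← mul_assoc]
  congr 1
  have hk0 : (0 : ℝ) < k := by exact_mod_cast hk
  field_simp
  norm_num

end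

end Hypersurface

theorem proposition2p2 (n k : ℕ) (hk : 1 ≤ k) (hkn : k ≤ n - 1)
    {M : Type*} [TopologicalSpace M] [T2Space M] [CompactSpace M]
    [ChartedSpace (EuclideanSpace ℝ (Fin (n - 1))) M] [IsManifold (𝓡 (n - 1)) ∞ M]
    [MeasurableSpace M] [BorelSpace M]
    (X ν : M → EuclideanSpace ℝ (Fin n))
    (hX : Hypersurface.IsImmersedWithUnitNormal (m := n - 1) X ν)
    (O : EuclideanSpace ℝ (Fin n)) :
    let μ := Hypersurface.areaMeasure (n - 1) X
    let r2 : M → ℝ := Hypersurface.rsq O X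
    let u : M → ℝ := Hypersurface.support O X ν
    let H : ℕ → M → ℝ := fun j => Hypersurface.H (n - 1) j X ν
    let TGrad : M → ℝ := Hypersurface.newtonGrad (n - 1) (k - 1) X ν r2
    let ThGrad : M → ℝ := Hypersurface.newtonShapeGrad (n - 1) (k - 1) X ν r2
    (Integrable (fun p => r2 p * u p * H k p) μ ∧
      Integrable (fun p => r2 p * H (k - 1) p) μ ∧
      Integrable TGrad μ ∧
      ∫ p, r2 p * u p * H k p ∂μ
        = (∫ p, r2 p * H (k - 1) p ∂μ)
          + 1 / (2 * (k : ℝ) * ((n - 1).choose k : ℝ)) * ∫ p, TGrad p ∂μ) ∧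
    (Integrable (fun p => u p ^ 2 * H k p) μ ∧
      Integrable (fun p => u p * H (k - 1) p) μ ∧
      Integrable ThGrad μ ∧
      ∫ p, u p ^ 2 * H k p ∂μ
        = (∫ p, u p * H (k - 1) p ∂μ)
          + 1 / (4 * (k : ℝ) * ((n - 1).choose k : ℝ)) * ∫ p, ThGrad p ∂μ) := by
  exact Hypersurface.integral_formulas (by omega) hk hkn X ν hX O
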